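/- Let $K$ be a field, $A=K[x_1,x_2,x_3,\dots]$ the polynomial ring in infinitely many variables, $A_{[n]}=K[x_1,\dots,x_n]$ (all variables of degree $1$), and $M$ the set of monomials of $A$. For a finitely generated monomial ideal $I\subset A$ let $G(I)$ be its set of minimal monomial generators and $\max(I)$ the largest $i$ such that $x_i$ divides some $u\in G(I)$ ($\max(I)=0$ if there is none). Let $\beta_{ij}(I)$ denote the graded Betti numbers $\dim_K \mathrm{Tor}_i(I\cap A_{[n]},K)_j$ of $I\cap A_{[n]}$ over $A_{[n]}$ for $n=\max(I)$, that is, the number of summands $A_{[n]}(-j)$ in homological degree $i$ of the minimal graded free resolution of $I\cap A_{[n]}$. For monomials $u=x_{i_1}\cdots x_{i_d}$ and $v=x_{j_1}\cdots x_{j_d}$ of the same degree with $i_1\le\cdots\le i_d$ and $j_1\le\cdots\le j_d$, write $u\prec v$ if $i_k\le j_k$ for all $k$. A monomial ideal of $A_{[n]}$ is strongly stable if $v\in I$ and $u\prec v$ imply $u\in I$ for monomials $u,v\in A_{[n]}$; a finitely generated monomial ideal $I\subset A$ is strongly stable if $I\cap A_{[\max(I)]}$ is. For a map $\sigma:M\to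 M$ let $\sigma(I)$ be the ideal generated by $\{\sigma(u):u\in G(I)\}$. The map $\sigma$ is called a stable operator if (i) $\beta_{ij}(I)=\beta_{ij}(\sigma(I))$ for all $i,j$ and all finitely generated strongly stable ideals $I\subset A$; and (ii) $\sigma(J)\subset\sigma(I)$ whenever $J\subset I$ are finitely generated strongly stable ideals of $A$. **Proposition 1.8.** Let $a=(0,a_1,a_2,\dots)$ be a nondecreasing infinite sequence of integers, and define $\alpha^a:M\to M$ by $$\alpha^a(x_{i_1}x_{i_2}\cdots x_{i_k})=x_{i_1}x_{i_2+a_1}x_{i_3+a_2}\cdots x_{i_k+a_{k-1}}\qquad(i_1\le i_2\le\cdots\le i_k).$$ Then $\alpha^a$ is a stable operator. -/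

import Mathlib

open MvPolynomial

noncomputable section

namespace StableOp

/-! Variables are indexed from `0`: the variable written `x_{i+1}` on paper is `X i`.  So
`MvPolynomial (Fin n) K` is `K[x_1, …, x_n]`, `MvPolynomial ℕ K` is `K[x_1, x_2, x_3, …]`, and a
monomial in the variables `ι` is its exponent vector in `ι →₀ ℕ`; the monomial `u` divides the
monomial `v` if and only if `u ≤ v`. -/

section GradedBetti

variable {K : Type*} [Field K] {n : ℕ}

/-- A minimal graded free resolution
`⋯ → F_2 → F_1 → F_0 → I → 0` over `S = K[x_1, …, x_n]` of the ideal `I` of `S`, where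
`F_i = ⨁_b S(-deg i b)` has the finite homogeneous basis `e_b`, `b : Fin (rank i)`,
with `e_b` in degree `deg i b`. -/
structure MinimalGradedFreeResolution (I : Ideal (MvPolynomial (Fin n) K)) where
  /-- the rank of the free module `F_i` -/
  rank : ℕ → ℕ
  /-- the degrees of the basis elements of `F_i` -/
  deg : (i : ℕ) → Fin (rank i) → ℕ
  /-- the augmentation `F_0 → I ⊆ S` -/
  aug : (Fin (rank 0) → MvPolynomial (Fin n) K) →ₗ[MvPolynomial (Fin n) K]
    MvPolynomial (Fin n) K
  /-- the differential `F_{i+1} → F_i` -/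
  d : (i : ℕ) → (Fin (rank (i + 1)) → MvPolynomial (Fin n) K) →ₗ[MvPolynomial (Fin n) K]
    (Fin (rank i) → MvPolynomial (Fin n) K)
  /-- the augmentation maps onto `I` -/
  range_aug : LinearMap.range aug = I
  /-- exactness at `F_0` -/
  exact_zero : Function.Exact (d 0) aug
  /-- exactness at `F_{i+1}` -/
  exact_succ : ∀ i, Function.Exact (d (i + 1)) (d i)
  /-- the augmentation preserves degrees -/
  aug_homogeneous : ∀ b, (aug (Pi.single b 1)).IsHomogeneous (deg 0 b)
  /-- the differentials preserve degrees: each entry of the matrix of `d i` is zero or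
  homogeneous of degree `deg (i + 1) b - deg i c` -/
  d_homogeneous : ∀ i b c, d i (Pi.single b 1) c = 0 ∨
    ∃ k, k + deg i c = deg (i + 1) b ∧ (d i (Pi.single b 1) c).IsHomogeneous k
  /-- minimality: the image of `d i` lies in `(x_1, …, x_n) F_i` -/
  minimal : ∀ i b c, constantCoeff (d i (Pi.single b 1) c) = 0

open Classical in
/-- The graded Betti number `β_{ij}(I) = dim_K Tor_i(I, K)_j` of a graded ideal `I` of
`K[x_1, …, x_n]`: the number of summands `S(-j)` of the `i`-th module in the minimal graded free
resolution of `I`.  (Every graded ideal has such a resolution, unique up to isomorphism;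
the value for other ideals is irrelevant.) -/
def gradedBetti (I : Ideal (MvPolynomial (Fin n) K)) (i j : ℕ) : ℕ :=
  if h : Nonempty (MinimalGradedFreeResolution I) then
    Fintype.card {b : Fin (h.some.rank i) // h.some.deg i b = j}
  else 0

end GradedBetti

/-- The indices `i_1 ≤ i_2 ≤ ⋯ ≤ i_k` of a monomial `u = x_{i_1} x_{i_2} ⋯ x_{i_k}`, listed with
multiplicity in nondecreasing order. -/
def indices {ι : Type*} [LinearOrder ι] (u : ι →₀ ℕ) : List ι :=
  (Finsupp.toMultiset u).sort (· ≤ ·)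

/-- The order `u ≺ v` on monomials: `u` and `v` have the same degree, and the indices of `u` are
termwise at most the indices of `v`. -/
def Prec {ι : Type*} [LinearOrder ι] (u v : ι →₀ ℕ) : Prop :=
  List.Forall₂ (· ≤ ·) (indices u) (indices v)

section Ideals

variable {K : Type*} [Field K]

/-- A monomial ideal is an ideal generated by monomials. -/
def IsMonomialIdeal {ι : Type*} (I : Ideal (MvPolynomial ι K)) : Prop :=
  ∃ A : Set (ι →₀ ℕ), I = Ideal.span ((fun u => monomial u (1 : K)) '' A)

/-- `G(I)`: the minimal monomial generators of a monomial ideal `I`, that is, the monomials of `I`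
that are minimal with respect to divisibility. -/
def minGens {ι : Type*} (I : Ideal (MvPolynomial ι K)) : Set (ι →₀ ℕ) :=
  {u | Minimal (fun v => monomial v (1 : K) ∈ I) u}

/-- A monomial ideal `I` of `K[x_1, …, x_n]` is strongly stable if `v ∈ I` and `u ≺ v` imply
`u ∈ I`, for monomials `u`, `v`. -/
def IsStronglyStable {n : ℕ} (I : Ideal (MvPolynomial (Fin n) K)) : Prop :=
  IsMonomialIdeal I ∧ ∀ u v : Fin n →₀ ℕ,
    monomial v (1 : K) ∈ I → Prec u v → monomial u (1 : K) ∈ I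

/-- `m(u) = max {i : x_i divides u}`, with `m(1) = 0`.  The variable `X i` counts as the
`(i + 1)`-st variable. -/
def maxIndex (u : ℕ →₀ ℕ) : ℕ := u.support.sup (· + 1)

/-- `max(I) = max {m(u) : u ∈ G(I)}`, with the value `0` for `I = 0`. -/
def maxVar (I : Ideal (MvPolynomial ℕ K)) : ℕ := sSup (maxIndex '' minGens I)

/-- `I ∩ K[x_1, …, x_n]`, an ideal of `K[x_1, …, x_n]`. -/
def restrictTo (n : ℕ) (I : Ideal (MvPolynomial ℕ K)) : Ideal (MvPolynomial (Fin n) K) :=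
  I.comap (rename (Fin.val : Fin n → ℕ) : MvPolynomial (Fin n) K →ₐ[K] MvPolynomial ℕ K)

/-- The graded Betti numbers of a finitely generated monomial ideal `I` of `K[x_1, x_2, …]`: those
of `I ∩ K[x_1, …, x_n]` over `K[x_1, …, x_n]`, where `n = max(I)`. -/
def betti (I : Ideal (MvPolynomial ℕ K)) (i j : ℕ) : ℕ :=
  gradedBetti (restrictTo (maxVar I) I) i j

/-- Finitely generated strongly stable ideals of `K[x_1, x_2, …]`: the finitely generated monomial
ideals `I` such that `I ∩ K[x_1, …, x_n]` is strongly stable, where `n = max(I)`. -/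
def IsFGStronglyStable (I : Ideal (MvPolynomial ℕ K)) : Prop :=
  I.FG ∧ IsMonomialIdeal I ∧ IsStronglyStable (restrictTo (maxVar I) I)

/-- `σ(I)`: the ideal generated by `σ(u)`, `u ∈ G(I)`. -/
def opIdeal (σ : (ℕ →₀ ℕ) → (ℕ →₀ ℕ)) (I : Ideal (MvPolynomial ℕ K)) :
    Ideal (MvPolynomial ℕ K) :=
  Ideal.span ((fun u => monomial (σ u) (1 : K)) '' minGens I)

end Ideals

/-- A map `σ` from the set of monomials of `K[x_1, x_2, …]` to itself is a stable operator if
`β_{ij}(I) = β_{ij}(σ(I))` for all finitely generated strongly stable ideals `I` and all `i`, `j`,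
and `σ(J) ⊆ σ(I)` for all finitely generated strongly stable ideals `J ⊆ I`. -/
structure IsStableOperator (K : Type*) [Field K] (σ : (ℕ →₀ ℕ) → (ℕ →₀ ℕ)) : Prop where
  betti_eq : ∀ I : Ideal (MvPolynomial ℕ K), IsFGStronglyStable I →
    ∀ i j : ℕ, betti I i j = betti (opIdeal σ I) i j
  mono : ∀ I J : Ideal (MvPolynomial ℕ K), IsFGStronglyStable I → IsFGStronglyStable J →
    J ≤ I → opIdeal σ J ≤ opIdeal σ I

/-- The shift map `x_{i_1} x_{i_2} ⋯ x_{i_k} ↦ x_{i_1 + a_0} x_{i_2 + a_1} ⋯ x_{i_k + a_{k-1}}`,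
where `i_1 ≤ i_2 ≤ ⋯ ≤ i_k`.  It is used for nondecreasing integer sequences `a` with `a_0 = 0`;
all their terms are natural numbers. -/
def shiftMap (a : ℕ → ℕ) (u : ℕ →₀ ℕ) : ℕ →₀ ℕ :=
  Multiset.toFinsupp (((indices u).mapIdx fun k i => i + a k : List ℕ) : Multiset ℕ)

end StableOp

end

/-!
For every nondecreasing sequence `a` and every finitely generated strongly stable ideal `I`,
`β_{i,j}(α^a(I)) = ∑_u binom(m(u) - 1, i)`, where `u` ranges over the elements of `G(I)` of degree
`j - i` (`betti_opIdeal_shiftMap`). The right-hand side does not depend on `a`, and `α^0(I) = I`,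
so the Betti numbers of `I` and `α^a(I)` agree.

The formula holds because `α^a(I)` has linear quotients. If the generators `u ∈ G(I)` are ordered by
degree and then by the sum of their indices, the colon ideal of the earlier `α^a(v)` with respect to
`α^a(u)` is generated by `m(u) - 1` variables (`exists_shiftMap_le_add_iff`, `card_colonVars`). This
rests on the fact that every monomial of `I`, written as a nondecreasing word, has an initial
segment in `G(I)` (`IsStronglyStableSet.exists_minimal_take`), and that `α^a` maps initial segments
to initial segments. The same fact gives the monotonicity of `α^a` at once
(`opIdeal_shiftMap_mono`).

For an ideal with linear quotients, a minimal graded free resolution is an iterated mapping cone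
(`GradedRes.exists_cone`, `hasBetti_of_linearQuotients`), and so are the Koszul complexes that
resolve the colon ideals (`hasBetti_variables`). The Betti numbers can be read off from any such
resolution because two minimal resolutions are homotopy equivalent (`GradedRes.card_eq`).
-/

open MvPolynomial

noncomputable section

namespace StableOp

/-! ### Graded maps between free modules -/

section GradedMaps

variable {τ K : Type*} [Field K]
variable {ι κ l : Type*}

/-- The vector `v` is homogeneous of degree `t` in the graded free module `⨁_c S(-δ c)`. -/
def IsHomogVec (δ : ι → ℕ) (t : ℕ) (v : ι → MvPolynomial τ K) : Prop :=
  ∀ c, v c = 0 ∨ ∃ k, k + δ c = t ∧ (v c).IsHomogeneous k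

/-- The component of degree `t` of the vector `v` in `⨁_c S(-δ c)`. -/
def gradedPart (δ : ι → ℕ) (t : ℕ) (v : ι → MvPolynomial τ K) : ι → MvPolynomial τ K :=
  fun c => if δ c ≤ t then homogeneousComponent (t - δ c) (v c) else 0

theorem isHomogVec_gradedPart (δ : ι → ℕ) (t : ℕ) (v : ι → MvPolynomial τ K) :
    IsHomogVec δ t (gradedPart δ t v) := by
  intro c
  unfold gradedPart
  split_ifs with h
  · exact Or.inr ⟨t - δ c, by omega, homogeneousComponent_isHomogeneous _ _⟩
  · exact Or.inl rfl

theorem gradedPart_eq_self {δ : ι → ℕ} {t : ℕ} {v : ι → MvPolynomial τ K}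
    (hv : IsHomogVec δ t v) : gradedPart δ t v = v := by
  funext c
  unfold gradedPart
  rcases hv c with h | ⟨k, hk, h⟩
  · simp [h]
  · rw [if_pos (by omega), show t - δ c = k by omega, homogeneousComponent_of_mem h, if_pos rfl]

theorem IsHomogVec.neg {δ : ι → ℕ} {t : ℕ} {v : ι → MvPolynomial τ K}
    (hv : IsHomogVec δ t v) : IsHomogVec δ t (-v) := by
  intro c
  rcases hv c with h | ⟨k, hk, h⟩
  · exact Or.inl (by simp [h])
  · exact Or.inr ⟨k, hk, h.neg⟩

theorem gradedPart_sum {β : Type*} (δ : ι → ℕ) (t : ℕ) (s : Finset β)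
    (v : β → ι → MvPolynomial τ K) :
    gradedPart δ t (∑ b ∈ s, v b) = ∑ b ∈ s, gradedPart δ t (v b) := by
  funext c
  simp only [gradedPart, Finset.sum_apply, map_sum]
  split_ifs <;> simp

theorem homogeneousComponent_mul_of_isHomogeneous {q : MvPolynomial τ K} {k : ℕ}
    (hq : q.IsHomogeneous k) (p : MvPolynomial τ K) (t : ℕ) :
    homogeneousComponent (t + k) (p * q) = homogeneousComponent t p * q := by
  conv_lhs => rw [← sum_homogeneousComponent p, Finset.sum_mul, map_sum]
  have : ∀ i ∈ Finset.range (p.totalDegree + 1),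
      homogeneousComponent (t + k) (homogeneousComponent i p * q) =
        if i = t then homogeneousComponent t p * q else 0 := by
    intro i _
    rw [homogeneousComponent_of_mem ((homogeneousComponent_isHomogeneous i p).mul hq)]
    by_cases h : i = t
    · simp [h]
    · rw [if_neg (by omega), if_neg h]
  rw [Finset.sum_congr rfl this, Finset.sum_ite_eq']
  split_ifs with h
  · rfl
  · rw [homogeneousComponent_eq_zero _ _ (by simpa using h), zero_mul]

theorem homogeneousComponent_mul_of_lt {q : MvPolynomial τ K} {k : ℕ}
    (hq : q.IsHomogeneous k) (p : MvPolynomial τ K) {t : ℕ} (ht : t < k) :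
    homogeneousComponent t (p * q) = 0 := by
  conv_lhs => rw [← sum_homogeneousComponent p, Finset.sum_mul, map_sum]
  refine Finset.sum_eq_zero fun i _ => ?_
  rw [homogeneousComponent_of_mem ((homogeneousComponent_isHomogeneous i p).mul hq),
    if_neg (by omega)]

theorem gradedPart_smul {δ : ι → ℕ} {s : ℕ} {v : ι → MvPolynomial τ K}
    (hv : IsHomogVec δ s v) (p : MvPolynomial τ K) (t : ℕ) :
    gradedPart δ t (p • v) =
      if s ≤ t then homogeneousComponent (t - s) p • v else 0 := by
  funext c
  have e : (if s ≤ t then homogeneousComponent (t - s) p • v else 0) c =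
      if s ≤ t then homogeneousComponent (t - s) p * v c else 0 := by
    split_ifs <;> rfl
  rw [e]
  unfold gradedPart
  rcases hv c with h | ⟨k, hk, h⟩
  · simp [h]
  · simp only [Pi.smul_apply, smul_eq_mul]
    by_cases hst : s ≤ t
    · rw [if_pos hst, if_pos (by omega), show t - δ c = (t - s) + k by omega,
        homogeneousComponent_mul_of_isHomogeneous h]
    · rw [if_neg hst]
      split_ifs with h2
      · exact homogeneousComponent_mul_of_lt h _ (by omega)
      · rfl

variable [Fintype ι] [DecidableEq ι]

/-- The map `f : ⨁_b S(-δ b) → ⨁_c S(-ε c)` preserves degrees. -/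
def IsGradedMap (δ : ι → ℕ) (ε : κ → ℕ)
    (f : (ι → MvPolynomial τ K) →ₗ[MvPolynomial τ K] (κ → MvPolynomial τ K)) : Prop :=
  ∀ b, IsHomogVec ε (δ b) (f (Pi.single b 1))

theorem map_eq_sum_smul (f : (ι → MvPolynomial τ K) →ₗ[MvPolynomial τ K] (κ → MvPolynomial τ K))
    (v : ι → MvPolynomial τ K) : f v = ∑ b, v b • f (Pi.single b 1) := by
  conv_lhs => rw [pi_eq_sum_univ' v]
  rw [map_sum]
  refine Finset.sum_congr rfl fun b _ => ?_
  rw [map_smul]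

theorem IsGradedMap.map_gradedPart {δ : ι → ℕ} {ε : κ → ℕ}
    {f : (ι → MvPolynomial τ K) →ₗ[MvPolynomial τ K] (κ → MvPolynomial τ K)}
    (hf : IsGradedMap δ ε f) (t : ℕ) (v : ι → MvPolynomial τ K) :
    f (gradedPart δ t v) = gradedPart ε t (f v) := by
  rw [map_eq_sum_smul f v, gradedPart_sum, map_eq_sum_smul]
  refine Finset.sum_congr rfl fun b _ => ?_
  rw [gradedPart_smul (hf b)]
  unfold gradedPart
  split_ifs <;> simp

theorem IsGradedMap.isHomogVec {δ : ι → ℕ} {ε : κ → ℕ}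
    {f : (ι → MvPolynomial τ K) →ₗ[MvPolynomial τ K] (κ → MvPolynomial τ K)}
    (hf : IsGradedMap δ ε f) {t : ℕ} {v : ι → MvPolynomial τ K} (hv : IsHomogVec δ t v) :
    IsHomogVec ε t (f v) := by
  rw [← gradedPart_eq_self hv, hf.map_gradedPart]
  exact isHomogVec_gradedPart _ _ _

omit [Fintype ι] in
theorem IsGradedMap.shift {δ : ι → ℕ} {ε : κ → ℕ}
    {f : (ι → MvPolynomial τ K) →ₗ[MvPolynomial τ K] (κ → MvPolynomial τ K)}
    (hf : IsGradedMap δ ε f) (e : ℕ) :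
    IsGradedMap (fun b => δ b + e) (fun b => ε b + e) f := by
  intro b c
  rcases hf b c with h | ⟨k, hk, h⟩
  · exact Or.inl h
  · exact Or.inr ⟨k, by simp only; omega, h⟩

omit [Fintype ι] in
theorem IsGradedMap.comp [Fintype κ] [DecidableEq κ] {δ : ι → ℕ} {ε : κ → ℕ} {η : l → ℕ}
    {f : (ι → MvPolynomial τ K) →ₗ[MvPolynomial τ K] (κ → MvPolynomial τ K)}
    {g : (κ → MvPolynomial τ K) →ₗ[MvPolynomial τ K] (l → MvPolynomial τ K)}
    (hg : IsGradedMap ε η g) (hf : IsGradedMap δ ε f) : IsGradedMap δ η (g ∘ₗ f) :=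
  fun b => hg.isHomogVec (hf b)

omit [Fintype ι] in
theorem isGradedMap_id (δ : ι → ℕ) :
    IsGradedMap δ δ (LinearMap.id : (ι → MvPolynomial τ K) →ₗ[MvPolynomial τ K] _) := by
  intro b c
  by_cases h : c = b
  · subst h
    exact Or.inr ⟨0, by simp, by simpa using isHomogeneous_one τ K⟩
  · exact Or.inl (by simp [h])

theorem exists_isHomogVec_of_mem_range {δ : ι → ℕ} {ε : κ → ℕ}
    {f : (ι → MvPolynomial τ K) →ₗ[MvPolynomial τ K] (κ → MvPolynomial τ K)}
    (hf : IsGradedMap δ ε f) {t : ℕ} {v : κ → MvPolynomial τ K} (hv : IsHomogVec ε t v)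
    (h : v ∈ LinearMap.range f) : ∃ u, IsHomogVec δ t u ∧ f u = v := by
  obtain ⟨u, rfl⟩ := h
  exact ⟨gradedPart δ t u, isHomogVec_gradedPart _ _ _, by
    rw [hf.map_gradedPart, gradedPart_eq_self hv]⟩

theorem comp_linearCombination [Fintype l]
    {D : (l → MvPolynomial τ K) →ₗ[MvPolynomial τ K] (κ → MvPolynomial τ K)}
    {f : (ι → MvPolynomial τ K) →ₗ[MvPolynomial τ K] (κ → MvPolynomial τ K)}
    {u : ι → l → MvPolynomial τ K} (h : ∀ b, D (u b) = f (Pi.single b 1)) :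
    D ∘ₗ Fintype.linearCombination (MvPolynomial τ K) u = f := by
  refine LinearMap.pi_ext' fun b => LinearMap.ext_ring ?_
  simp only [LinearMap.comp_apply, LinearMap.single_apply,
    Fintype.linearCombination_apply_single, one_smul, h]

/-- Graded free modules are projective in the category of graded modules: a graded map `f` into
the image of a graded map `D` lifts to a graded map. -/
theorem exists_graded_lift [Fintype l] [DecidableEq l] {δ : ι → ℕ} {ε : κ → ℕ} {η : l → ℕ}
    {D : (l → MvPolynomial τ K) →ₗ[MvPolynomial τ K] (κ → MvPolynomial τ K)}
    {f : (ι → MvPolynomial τ K) →ₗ[MvPolynomial τ K] (κ → MvPolynomial τ K)}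
    (hD : IsGradedMap η ε D) (hf : IsGradedMap δ ε f)
    (h : LinearMap.range f ≤ LinearMap.range D) :
    ∃ g : (ι → MvPolynomial τ K) →ₗ[MvPolynomial τ K] (l → MvPolynomial τ K),
      IsGradedMap δ η g ∧ D ∘ₗ g = f := by
  choose u hu hDu using fun b =>
    exists_isHomogVec_of_mem_range hD (hf b) (h (LinearMap.mem_range_self f (Pi.single b 1)))
  refine ⟨Fintype.linearCombination (MvPolynomial τ K) u, fun b => ?_, comp_linearCombination hDu⟩
  rw [Fintype.linearCombination_apply_single, one_smul]
  exact hu b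

theorem exists_lift [Fintype l]
    {D : (l → MvPolynomial τ K) →ₗ[MvPolynomial τ K] (κ → MvPolynomial τ K)}
    {f : (ι → MvPolynomial τ K) →ₗ[MvPolynomial τ K] (κ → MvPolynomial τ K)}
    (h : LinearMap.range f ≤ LinearMap.range D) :
    ∃ g : (ι → MvPolynomial τ K) →ₗ[MvPolynomial τ K] (l → MvPolynomial τ K),
      D ∘ₗ g = f := by
  choose u hDu using fun b => h (LinearMap.mem_range_self f (Pi.single b 1))
  exact ⟨Fintype.linearCombination (MvPolynomial τ K) u, comp_linearCombination hDu⟩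

theorem constantCoeff_map_eq_zero
    {f : (ι → MvPolynomial τ K) →ₗ[MvPolynomial τ K] (κ → MvPolynomial τ K)}
    (hf : ∀ b c, constantCoeff (f (Pi.single b 1) c) = 0) (v : ι → MvPolynomial τ K) (c : κ) :
    constantCoeff (f v c) = 0 := by
  rw [map_eq_sum_smul f v]
  simp [Finset.sum_apply, hf]

theorem constantCoeff_map_of_constantCoeff_eq_zero
    (f : (ι → MvPolynomial τ K) →ₗ[MvPolynomial τ K] (κ → MvPolynomial τ K))
    {v : ι → MvPolynomial τ K} (hv : ∀ b, constantCoeff (v b) = 0) (c : κ) :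
    constantCoeff (f v c) = 0 := by
  rw [map_eq_sum_smul f v]
  simp [Finset.sum_apply, hv]

theorem constantCoeff_eq_zero_of_isHomogVec {ε : κ → ℕ} {t : ℕ} {v : κ → MvPolynomial τ K}
    (hv : IsHomogVec ε t v) {c : κ} (hc : ε c ≠ t) : constantCoeff (v c) = 0 := by
  rcases hv c with h | ⟨k, hk, h⟩
  · simp [h]
  · have hk0 : k ≠ 0 := by omega
    rw [constantCoeff_eq]
    exact h.coeff_eq_zero (by simpa using hk0.symm)

/-- If `g ∘ f` is the identity modulo the maximal ideal `𝔪` of the variables and `f` preserves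
degrees, then the source of `f` has at most as many basis elements of each degree as the target:
modulo `𝔪`, the map `f` is block diagonal with respect to the degrees, and the block of degree `j`
is a matrix over `K` with a left inverse. -/
theorem card_degree_le [Fintype κ] [DecidableEq κ] {δ : ι → ℕ} {ε : κ → ℕ}
    {f : (ι → MvPolynomial τ K) →ₗ[MvPolynomial τ K] (κ → MvPolynomial τ K)}
    {g : (κ → MvPolynomial τ K) →ₗ[MvPolynomial τ K] (ι → MvPolynomial τ K)}
    (hf : IsGradedMap δ ε f)
    (h : ∀ b c, constantCoeff
      ((g (f (Pi.single b 1)) - Pi.single b 1 : ι → MvPolynomial τ K) c) = 0) (j : ℕ) :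
    Nat.card {b // δ b = j} ≤ Nat.card {c // ε c = j} := by
  classical
  let A : Matrix {c // ε c = j} {b // δ b = j} K :=
    fun c b => constantCoeff (f (Pi.single b.1 1) c.1)
  let B : Matrix {b // δ b = j} {c // ε c = j} K :=
    fun b c => constantCoeff (g (Pi.single c.1 1) b.1)
  have hBA : B * A = 1 := by
    ext b' b
    have h1 := h b.1 b'.1
    rw [Pi.sub_apply, map_sub, sub_eq_zero, map_eq_sum_smul g, Finset.sum_apply, map_sum] at h1
    have h2 : ∑ c, constantCoeff ((f (Pi.single b.1 1) c • g (Pi.single c 1)) b'.1) =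
        ∑ c : {c // ε c = j}, B b' c * A c b := by
      rw [← Finset.sum_subset (Finset.subset_univ (Finset.univ.filter fun c => ε c = j)),
        Finset.sum_subtype (p := fun c => ε c = j) _ (by simp)]
      · refine Finset.sum_congr rfl fun c _ => ?_
        simp only [Pi.smul_apply, smul_eq_mul, map_mul, A, B, mul_comm]
      · intro c _ hc
        have hc' : ε c ≠ δ b.1 := by simpa [b.2] using hc
        simp [constantCoeff_eq_zero_of_isHomogVec (hf b.1) hc']
    rw [Matrix.mul_apply, ← h2, h1, Matrix.one_apply]
    by_cases hb : b' = b
    · subst hb; simp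
    · have : b'.1 ≠ b.1 := fun h => hb (Subtype.ext h)
      simp [hb, this]
  have h1 := Matrix.rank_mul_le_left B A
  rw [hBA, Matrix.rank_one] at h1
  rw [Nat.card_eq_fintype_card, Nat.card_eq_fintype_card]
  exact h1.trans (Matrix.rank_le_card_width B)

end GradedMaps

/-! ### Uniqueness of the ranks of minimal resolutions -/

section Resolutions

variable {τ K : Type*} [Field K]

/-- A minimal graded free resolution of `I`, as in `MinimalGradedFreeResolution`, with two changes
of encoding: the variables and the bases are indexed by arbitrary (for the bases: finite) types,
and the augmentation takes values in the free module `Unit → S` of rank one, so that it has the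
same form as the differentials. -/
structure GradedRes (I : Ideal (MvPolynomial τ K)) where
  /-- the index type of the basis of `F_i` -/
  idx : ℕ → Type
  [fintype : ∀ i, Fintype (idx i)]
  [decEq : ∀ i, DecidableEq (idx i)]
  /-- the degrees of the basis elements of `F_i` -/
  deg : ∀ i, idx i → ℕ
  /-- the augmentation `F_0 → S` -/
  aug : (idx 0 → MvPolynomial τ K) →ₗ[MvPolynomial τ K] (Unit → MvPolynomial τ K)
  /-- the differential `F_{i+1} → F_i` -/
  d : ∀ i, (idx (i + 1) → MvPolynomial τ K) →ₗ[MvPolynomial τ K] (idx i → MvPolynomial τ K)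
  mem_range_aug : ∀ p, p ∈ LinearMap.range aug ↔ p () ∈ I
  exact_zero : Function.Exact (d 0) aug
  exact_succ : ∀ i, Function.Exact (d (i + 1)) (d i)
  aug_graded : IsGradedMap (deg 0) (fun _ => 0) aug
  d_graded : ∀ i, IsGradedMap (deg (i + 1)) (deg i) (d i)
  minimal : ∀ i b c, constantCoeff (d i (Pi.single b 1) c) = 0

attribute [instance] GradedRes.fintype GradedRes.decEq

namespace GradedRes

variable {I J : Ideal (MvPolynomial τ K)} (A : GradedRes I) (B : GradedRes J)

/-- The index types of the bases in the augmented complex `⋯ → F_1 → F_0 → S`, which resolves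
`S / I`: the module `S` sits in position `0`, and `F_i` in position `i + 1`. -/
def chainIdx : ℕ → Type
  | 0 => Unit
  | i + 1 => A.idx i

instance : ∀ i, Fintype (A.chainIdx i)
  | 0 => inferInstanceAs (Fintype Unit)
  | i + 1 => A.fintype i

instance : ∀ i, DecidableEq (A.chainIdx i)
  | 0 => inferInstanceAs (DecidableEq Unit)
  | i + 1 => A.decEq i

/-- The degrees of the basis elements in the augmented complex `⋯ → F_1 → F_0 → S`. -/
def chainDeg : ∀ i, A.chainIdx i → ℕ
  | 0 => fun _ => 0
  | i + 1 => A.deg i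

/-- The maps of the augmented complex `⋯ → F_1 → F_0 → S`. -/
def chainD : ∀ i, (A.chainIdx (i + 1) → MvPolynomial τ K) →ₗ[MvPolynomial τ K]
    (A.chainIdx i → MvPolynomial τ K)
  | 0 => A.aug
  | i + 1 => A.d i

theorem chainD_graded : ∀ i, IsGradedMap (A.chainDeg (i + 1)) (A.chainDeg i) (A.chainD i)
  | 0 => A.aug_graded
  | i + 1 => A.d_graded i

theorem chainD_exact : ∀ i, Function.Exact (A.chainD (i + 1)) (A.chainD i)
  | 0 => A.exact_zero
  | i + 1 => A.exact_succ i

theorem chainD_minimal (i : ℕ) (b c) : constantCoeff (A.chainD (i + 1) (Pi.single b 1) c) = 0 :=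
  A.minimal i b c

theorem range_comp_chainD_le {i : ℕ} (f : (A.chainIdx i → MvPolynomial τ K) →ₗ[MvPolynomial τ K]
    (B.chainIdx i → MvPolynomial τ K))
    (g : (A.chainIdx (i + 1) → MvPolynomial τ K) →ₗ[MvPolynomial τ K]
      (B.chainIdx (i + 1) → MvPolynomial τ K))
    (h : B.chainD i ∘ₗ g = f ∘ₗ A.chainD i) :
    LinearMap.range (g ∘ₗ A.chainD (i + 1)) ≤ LinearMap.range (B.chainD (i + 1)) := by
  rintro _ ⟨v, rfl⟩
  have h1 := LinearMap.congr_fun h (A.chainD (i + 1) v)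
  simp only [LinearMap.comp_apply, (A.chainD_exact i).apply_apply_eq_zero, map_zero] at h1
  exact (B.chainD_exact i _).1 h1

/-- One step in the construction of a comparison map. The map raises degrees by `e`; that is, it
preserves degrees as a map from the shifted complex `A(-e)` to `B`. -/
theorem exists_comparison_step (e : ℕ) {i : ℕ}
    {f : (A.chainIdx i → MvPolynomial τ K) →ₗ[MvPolynomial τ K] (B.chainIdx i → MvPolynomial τ K)}
    (hf : IsGradedMap (fun b => A.chainDeg i b + e) (B.chainDeg i) f)
    (h : LinearMap.range (f ∘ₗ A.chainD i) ≤ LinearMap.range (B.chainD i)) :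
    ∃ g : (A.chainIdx (i + 1) → MvPolynomial τ K) →ₗ[MvPolynomial τ K]
        (B.chainIdx (i + 1) → MvPolynomial τ K),
      IsGradedMap (fun b => A.chainDeg (i + 1) b + e) (B.chainDeg (i + 1)) g ∧
        B.chainD i ∘ₗ g = f ∘ₗ A.chainD i ∧
        LinearMap.range (g ∘ₗ A.chainD (i + 1)) ≤ LinearMap.range (B.chainD (i + 1)) := by
  obtain ⟨g, hg, hc⟩ := exists_graded_lift (B.chainD_graded i)
    (hf.comp ((A.chainD_graded i).shift e)) h
  exact ⟨g, hg, hc, range_comp_chainD_le A B f g hc⟩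

/-- A map of degree `e` in position `0` extends to a map of complexes of degree `e`. -/
theorem exists_comparison (e : ℕ)
    (f₀ : (A.chainIdx 0 → MvPolynomial τ K) →ₗ[MvPolynomial τ K] (B.chainIdx 0 → MvPolynomial τ K))
    (hf : IsGradedMap (fun b => A.chainDeg 0 b + e) (B.chainDeg 0) f₀)
    (h : LinearMap.range (f₀ ∘ₗ A.chainD 0) ≤ LinearMap.range (B.chainD 0)) :
    ∃ f : ∀ i, (A.chainIdx i → MvPolynomial τ K) →ₗ[MvPolynomial τ K]
        (B.chainIdx i → MvPolynomial τ K),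
      f 0 = f₀ ∧ (∀ i, IsGradedMap (fun b => A.chainDeg i b + e) (B.chainDeg i) (f i)) ∧
        ∀ i, B.chainD i ∘ₗ f (i + 1) = f i ∘ₗ A.chainD i := by
  let T : ℕ → Type _ := fun i =>
    {f : (A.chainIdx i → MvPolynomial τ K) →ₗ[MvPolynomial τ K] (B.chainIdx i → MvPolynomial τ K) //
      IsGradedMap (fun b => A.chainDeg i b + e) (B.chainDeg i) f ∧
        LinearMap.range (f ∘ₗ A.chainD i) ≤ LinearMap.range (B.chainD i)}
  have step : ∀ i (f : T i), ∃ g : T (i + 1), B.chainD i ∘ₗ g.1 = f.1 ∘ₗ A.chainD i := by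
    rintro i ⟨f, hf, h⟩
    obtain ⟨g, hg, hc, hr⟩ := exists_comparison_step A B e hf h
    exact ⟨⟨g, hg, hr⟩, hc⟩
  choose next hnext using step
  let F : ∀ i, T i := fun i => Nat.rec (motive := T) ⟨f₀, hf, h⟩ next i
  exact ⟨fun i => (F i).1, rfl, fun i => (F i).2.1, fun i => hnext i (F i)⟩

/-- One step of the construction of a chain homotopy between `θ` and the identity. -/
theorem exists_homotopy_step {i : ℕ}
    {θ : (A.chainIdx i → MvPolynomial τ K) →ₗ[MvPolynomial τ K] (A.chainIdx i → MvPolynomial τ K)}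
    {θ' : (A.chainIdx (i + 1) → MvPolynomial τ K) →ₗ[MvPolynomial τ K]
      (A.chainIdx (i + 1) → MvPolynomial τ K)}
    {s : (A.chainIdx i → MvPolynomial τ K) →ₗ[MvPolynomial τ K]
      (A.chainIdx (i + 1) → MvPolynomial τ K)}
    (hθ : A.chainD i ∘ₗ θ' = θ ∘ₗ A.chainD i)
    (hs : ∀ v, A.chainD i (s (A.chainD i v)) = θ (A.chainD i v) - A.chainD i v) :
    ∃ s' : (A.chainIdx (i + 1) → MvPolynomial τ K) →ₗ[MvPolynomial τ K]
        (A.chainIdx (i + 2) → MvPolynomial τ K),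
      ∀ v, A.chainD (i + 1) (s' v) = θ' v - v - s (A.chainD i v) := by
  have h : LinearMap.range (θ' - LinearMap.id - s ∘ₗ A.chainD i) ≤
      LinearMap.range (A.chainD (i + 1)) := by
    rintro _ ⟨v, rfl⟩
    refine (A.chainD_exact i _).1 ?_
    have h1 := LinearMap.congr_fun hθ v
    simp only [LinearMap.comp_apply] at h1
    simp [h1, hs]
  obtain ⟨s', hs'⟩ := exists_lift h
  exact ⟨s', fun v => by simpa using LinearMap.congr_fun hs' v⟩

variable {A B}

/-- Comparison maps `f : A → B` and `g : B → A` over the identity of `S` have `g ∘ f` homotopic to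
the identity, hence equal to it modulo `𝔪` by minimality. The maps `f`, `g` and the homotopy `s` are
built position by position, with only the facts that the next step uses. -/
theorem card_le (A B : GradedRes I) (i j : ℕ) :
    Nat.card {b // A.deg i b = j} ≤ Nat.card {b // B.deg i b = j} := by
  have key : ∀ i, ∃ (f : (A.chainIdx i → MvPolynomial τ K) →ₗ[MvPolynomial τ K]
        (B.chainIdx i → MvPolynomial τ K))
      (g : (B.chainIdx i → MvPolynomial τ K) →ₗ[MvPolynomial τ K] (A.chainIdx i → MvPolynomial τ K))
      (s : (A.chainIdx i → MvPolynomial τ K) →ₗ[MvPolynomial τ K]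
        (A.chainIdx (i + 1) → MvPolynomial τ K)),
      IsGradedMap (fun b => A.chainDeg i b + 0) (B.chainDeg i) f ∧
      IsGradedMap (fun b => B.chainDeg i b + 0) (A.chainDeg i) g ∧
      LinearMap.range (f ∘ₗ A.chainD i) ≤ LinearMap.range (B.chainD i) ∧
      LinearMap.range (g ∘ₗ B.chainD i) ≤ LinearMap.range (A.chainD i) ∧
      (∀ v, A.chainD i (s (A.chainD i v)) = (g ∘ₗ f) (A.chainD i v) - A.chainD i v) ∧
      (∀ v c, constantCoeff (s (A.chainD i v) c) = 0) ∧
      ∀ j, i = j + 1 → ∀ b c,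
        constantCoeff ((g (f (Pi.single b 1)) - Pi.single b 1 : _ → MvPolynomial τ K) c) = 0 := by
    intro i
    induction i with
    | zero =>
      have hr : LinearMap.range (A.chainD 0) = LinearMap.range (B.chainD 0) := by
        ext p
        exact (A.mem_range_aug p).trans (B.mem_range_aug p).symm
      refine ⟨LinearMap.id, LinearMap.id, 0, isGradedMap_id (fun _ : Unit => 0),
        isGradedMap_id (fun _ : Unit => 0), ?_, ?_, ?_, ?_, ?_⟩
      · exact hr.le
      · exact hr.ge
      · intro v
        simp only [LinearMap.zero_apply, map_zero]
        exact (sub_self _).symm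
      · intro v c; simp
      · intro j hj; omega
    | succ i ih =>
      obtain ⟨f, g, s, hf, hg, hfr, hgr, hs, hm, -⟩ := ih
      obtain ⟨f', hf', hfc, hfr'⟩ := exists_comparison_step A B 0 hf hfr
      obtain ⟨g', hg', hgc, hgr'⟩ := exists_comparison_step B A 0 hg hgr
      have hθ : A.chainD i ∘ₗ (g' ∘ₗ f') = (g ∘ₗ f) ∘ₗ A.chainD i := by
        rw [← LinearMap.comp_assoc, hgc, LinearMap.comp_assoc, hfc, LinearMap.comp_assoc]
      obtain ⟨s', hs'⟩ := exists_homotopy_step A hθ hs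
      refine ⟨f', g', s', hf', hg', hfr', hgr', ?_, fun v c => ?_, ?_⟩
      · intro v
        rw [hs', (A.chainD_exact i).apply_apply_eq_zero, map_zero, sub_zero]
      · exact constantCoeff_map_of_constantCoeff_eq_zero s'
          (constantCoeff_map_eq_zero (A.chainD_minimal i) v) c
      · rintro j - b c
        have h1 : g' (f' (Pi.single b 1)) - Pi.single b 1 =
            A.chainD (i + 1) (s' (Pi.single b 1)) + s (A.chainD i (Pi.single b 1)) := by
          rw [hs']; simp
        rw [h1, Pi.add_apply, map_add, constantCoeff_map_eq_zero (A.chainD_minimal i), zero_add]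
        exact hm _ c
  obtain ⟨f, g, s, hf, hg, -, -, -, -, h⟩ := key (i + 1)
  exact card_degree_le hf (h i rfl) j

/-- Two minimal graded free resolutions of the same ideal have the same number of basis elements in
each homological and internal degree. -/
theorem card_eq (A B : GradedRes I) (i j : ℕ) :
    Nat.card {b // A.deg i b = j} = Nat.card {b // B.deg i b = j} :=
  le_antisymm (card_le A B i j) (card_le B A i j)

end GradedRes

end Resolutions

/-! ### Graded Betti numbers from an arbitrary resolution -/

section FromResolution

variable {n : ℕ} {K : Type*} [Field K] {I : Ideal (MvPolynomial (Fin n) K)}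

/-- A `MinimalGradedFreeResolution` as a `GradedRes`. -/
def MinimalGradedFreeResolution.toGradedRes (F : MinimalGradedFreeResolution I) :
    GradedRes I where
  idx i := Fin (F.rank i)
  deg := F.deg
  aug := LinearMap.pi fun _ => F.aug
  d := F.d
  mem_range_aug p := by
    have h : p ∈ LinearMap.range (LinearMap.pi fun _ : Unit => F.aug) ↔
        p () ∈ LinearMap.range F.aug :=
      exists_congr fun v => ⟨fun h => congrFun h (), fun h => funext fun _ => h⟩
    exact h.trans (iff_of_eq (congrArg (p () ∈ ·) F.range_aug))
  exact_zero v := by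
    rw [← F.exact_zero v]
    exact ⟨fun h => congrFun h (), fun h => funext fun _ => h⟩
  exact_succ := F.exact_succ
  aug_graded b _ := Or.inr ⟨F.deg 0 b, rfl, F.aug_homogeneous b⟩
  d_graded := F.d_homogeneous
  minimal := F.minimal

theorem GradedRes.nonempty_minimalGradedFreeResolution (A : GradedRes I) :
    Nonempty (MinimalGradedFreeResolution I) := by
  let e : ∀ i, A.idx i ≃ Fin (Fintype.card (A.idx i)) := fun i => Fintype.equivFin _
  let E : ∀ i, (Fin (Fintype.card (A.idx i)) → MvPolynomial (Fin n) K) ≃ₗ[MvPolynomial (Fin n) K]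
      (A.idx i → MvPolynomial (Fin n) K) := fun i => LinearEquiv.funCongrLeft _ _ (e i)
  have hE : ∀ i b, E i (Pi.single b 1) = Pi.single ((e i).symm b) 1 := by
    intro i b
    funext c
    simp [E, LinearEquiv.funCongrLeft_apply, LinearMap.funLeft_apply, Pi.single_apply,
      Equiv.eq_symm_apply]
  exact ⟨{
    rank := fun i => Fintype.card (A.idx i)
    deg := fun i b => A.deg i ((e i).symm b)
    aug := LinearMap.proj () ∘ₗ A.aug ∘ₗ (E 0).toLinearMap
    d := fun i => (E i).symm.toLinearMap ∘ₗ A.d i ∘ₗ (E (i + 1)).toLinearMap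
    range_aug := by
      ext p
      refine Iff.trans ?_ (A.mem_range_aug fun _ => p)
      constructor
      · rintro ⟨v, rfl⟩
        exact ⟨E 0 v, rfl⟩
      · rintro ⟨v, hv⟩
        exact ⟨(E 0).symm v, by simp [hv]⟩
    exact_zero := by
      intro v
      have h := A.exact_zero (E 0 v)
      constructor
      · intro hv
        obtain ⟨u, hu⟩ := h.1 (funext fun _ => hv)
        exact ⟨(E 1).symm u, by simp [hu]⟩
      · rintro ⟨u, rfl⟩
        have := A.exact_zero.apply_apply_eq_zero (E 1 u)
        simp [this]
    exact_succ := by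
      intro i v
      have h := A.exact_succ i (E (i + 1) v)
      constructor
      · intro hv
        obtain ⟨u, hu⟩ := h.1 (by simpa using hv)
        exact ⟨(E (i + 2)).symm u, by simp [hu]⟩
      · rintro ⟨u, rfl⟩
        have := (A.exact_succ i).apply_apply_eq_zero (E (i + 2) u)
        simp [this]
    aug_homogeneous := by
      intro b
      have h := A.aug_graded ((e 0).symm b) ()
      simp only [LinearMap.comp_apply, LinearEquiv.coe_coe, hE, LinearMap.proj_apply]
      rcases h with h | ⟨k, hk, h⟩
      · rw [h]; exact isHomogeneous_zero _ _ _
      · rw [show A.deg 0 ((e 0).symm b) = k by simpa using hk.symm]; exact h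
    d_homogeneous := by
      intro i b c
      simp only [LinearMap.comp_apply, LinearEquiv.coe_coe, hE]
      exact A.d_graded i ((e (i + 1)).symm b) ((e i).symm c)
    minimal := by
      intro i b c
      simp only [LinearMap.comp_apply, LinearEquiv.coe_coe, hE]
      exact A.minimal i ((e (i + 1)).symm b) ((e i).symm c) }⟩

theorem GradedRes.gradedBetti_eq (A : GradedRes I) (i j : ℕ) :
    gradedBetti I i j = Nat.card {b // A.deg i b = j} := by
  have h := A.nonempty_minimalGradedFreeResolution
  rw [gradedBetti, dif_pos h, ← Nat.card_eq_fintype_card]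
  exact h.some.toGradedRes.card_eq A i j

end FromResolution

/-! ### Mapping cones -/

section Cone

variable {τ K : Type*} [Field K]

section Maps

variable {α α' β β' : Type*}

/-- The differential `(f, g) ↦ (D f + φ g, -E g)` of the mapping cone of a map `φ` of complexes,
where `D` and `E` are the differentials of the target and of the source of `φ`. -/
def coneMap (D : (α' → MvPolynomial τ K) →ₗ[MvPolynomial τ K] (α → MvPolynomial τ K))
    (φ : (β' → MvPolynomial τ K) →ₗ[MvPolynomial τ K] (α → MvPolynomial τ K))
    (E : (β' → MvPolynomial τ K) →ₗ[MvPolynomial τ K] (β → MvPolynomial τ K)) :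
    (α' ⊕ β' → MvPolynomial τ K) →ₗ[MvPolynomial τ K] (α ⊕ β → MvPolynomial τ K) :=
  (LinearEquiv.sumArrowLequivProdArrow α β _ _).symm.toLinearMap ∘ₗ
    (LinearMap.prod (D ∘ₗ LinearMap.funLeft _ _ Sum.inl + φ ∘ₗ LinearMap.funLeft _ _ Sum.inr)
      (-(E ∘ₗ LinearMap.funLeft _ _ Sum.inr)))

variable {D : (α' → MvPolynomial τ K) →ₗ[MvPolynomial τ K] (α → MvPolynomial τ K)}
  {φ : (β' → MvPolynomial τ K) →ₗ[MvPolynomial τ K] (α → MvPolynomial τ K)}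
  {E : (β' → MvPolynomial τ K) →ₗ[MvPolynomial τ K] (β → MvPolynomial τ K)}

theorem coneMap_apply (v : α' ⊕ β' → MvPolynomial τ K) :
    coneMap D φ E v =
      Sum.elim (D (v ∘ Sum.inl) + φ (v ∘ Sum.inr)) (-E (v ∘ Sum.inr)) := by
  funext c
  cases c <;> rfl

theorem coneMap_eq_iff (v : α' ⊕ β' → MvPolynomial τ K) (f : α → MvPolynomial τ K)
    (g : β → MvPolynomial τ K) :
    coneMap D φ E v = Sum.elim f g ↔
      D (v ∘ Sum.inl) + φ (v ∘ Sum.inr) = f ∧ -E (v ∘ Sum.inr) = g := by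
  rw [coneMap_apply]
  exact Sum.elim_eq_iff

variable (D φ) in
/-- The lowest map `(f, g) ↦ D f + φ g` of a mapping cone. -/
def coneAug : (α' ⊕ β' → MvPolynomial τ K) →ₗ[MvPolynomial τ K] (α → MvPolynomial τ K) :=
  D ∘ₗ LinearMap.funLeft _ _ Sum.inl + φ ∘ₗ LinearMap.funLeft _ _ Sum.inr

theorem coneAug_apply (v : α' ⊕ β' → MvPolynomial τ K) :
    coneAug D φ v = D (v ∘ Sum.inl) + φ (v ∘ Sum.inr) := rfl

variable [DecidableEq α'] [DecidableEq β']

theorem single_inl_comp (b : α') :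
    (Pi.single (Sum.inl b) 1 : α' ⊕ β' → MvPolynomial τ K) ∘ Sum.inl = Pi.single b 1 ∧
    (Pi.single (Sum.inl b) 1 : α' ⊕ β' → MvPolynomial τ K) ∘ Sum.inr = 0 := by
  constructor <;> funext c <;> simp [Pi.single_apply]

theorem single_inr_comp (b : β') :
    (Pi.single (Sum.inr b) 1 : α' ⊕ β' → MvPolynomial τ K) ∘ Sum.inl = 0 ∧
    (Pi.single (Sum.inr b) 1 : α' ⊕ β' → MvPolynomial τ K) ∘ Sum.inr = Pi.single b 1 := by
  constructor <;> funext c <;> simp [Pi.single_apply]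

theorem coneMap_single_inl (b : α') :
    coneMap D φ E (Pi.single (Sum.inl b) 1) = Sum.elim (D (Pi.single b 1)) 0 := by
  rw [coneMap_apply, (single_inl_comp b).1, (single_inl_comp b).2]
  simp

theorem coneMap_single_inr (b : β') :
    coneMap D φ E (Pi.single (Sum.inr b) 1) =
      Sum.elim (φ (Pi.single b 1)) (-E (Pi.single b 1)) := by
  rw [coneMap_apply, (single_inr_comp b).1, (single_inr_comp b).2]
  simp

theorem isGradedMap_coneMap {δ : α → ℕ} {δ' : α' → ℕ} {ε : β → ℕ} {ε' : β' → ℕ}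
    (hD : IsGradedMap δ' δ D) (hφ : IsGradedMap ε' δ φ) (hE : IsGradedMap ε' ε E) :
    IsGradedMap (Sum.elim δ' ε') (Sum.elim δ ε) (coneMap D φ E) := by
  rintro (b | b) c
  · rw [coneMap_single_inl]
    rcases c with c | c
    · exact hD b c
    · exact Or.inl rfl
  · rw [coneMap_single_inr]
    rcases c with c | c
    · exact hφ b c
    · exact (hE b).neg c

theorem isGradedMap_coneAug {δ : α → ℕ} {δ' : α' → ℕ} {ε' : β' → ℕ}
    (hD : IsGradedMap δ' δ D) (hφ : IsGradedMap ε' δ φ) :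
    IsGradedMap (Sum.elim δ' ε') δ (coneAug D φ) := by
  rintro (b | b)
  · rw [coneAug_apply, (single_inl_comp b).1, (single_inl_comp b).2, map_zero, add_zero]
    exact hD b
  · rw [coneAug_apply, (single_inr_comp b).1, (single_inr_comp b).2, map_zero, zero_add]
    exact hφ b

theorem constantCoeff_coneMap (hD : ∀ b c, constantCoeff (D (Pi.single b 1) c) = 0)
    (hφ : ∀ b c, constantCoeff (φ (Pi.single b 1) c) = 0)
    (hE : ∀ b c, constantCoeff (E (Pi.single b 1) c) = 0) :
    ∀ b c, constantCoeff (coneMap D φ E (Pi.single b 1) c) = 0 := by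
  rintro (b | b) c
  · rw [coneMap_single_inl]
    rcases c with c | c
    · exact hD b c
    · exact map_zero _
  · rw [coneMap_single_inr]
    rcases c with c | c
    · exact hφ b c
    · rw [Sum.elim_inr, Pi.neg_apply, map_neg, hE, neg_zero]

end Maps

namespace GradedRes

variable {I Q : Ideal (MvPolynomial τ K)}

/-- A cycle of the mapping cone whose second component is a boundary is a boundary. -/
theorem mem_range_coneMap (A : GradedRes I) (B : GradedRes Q) {i : ℕ}
    {φ : (B.chainIdx i → MvPolynomial τ K) →ₗ[MvPolynomial τ K] (A.chainIdx i → MvPolynomial τ K)}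
    {φ' : (B.chainIdx (i + 1) → MvPolynomial τ K) →ₗ[MvPolynomial τ K]
      (A.chainIdx (i + 1) → MvPolynomial τ K)}
    (hφ : A.chainD i ∘ₗ φ' = φ ∘ₗ B.chainD i)
    (v : A.chainIdx (i + 1) ⊕ B.chainIdx i → MvPolynomial τ K)
    (h : A.chainD i (v ∘ Sum.inl) + φ (v ∘ Sum.inr) = 0)
    (hv : v ∘ Sum.inr ∈ LinearMap.range (B.chainD i)) :
    v ∈ Set.range (coneMap (A.chainD (i + 1)) φ' (B.chainD i)) := by
  obtain ⟨g, hg⟩ := hv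
  have h1 := LinearMap.congr_fun hφ g
  simp only [LinearMap.comp_apply, hg] at h1
  obtain ⟨f, hf⟩ := (A.chainD_exact i (v ∘ Sum.inl + φ' g)).1 (by rw [map_add, h1, h])
  refine ⟨Sum.elim f (-g), ?_⟩
  rw [← Sum.elim_comp_inl_inr v, coneMap_eq_iff]
  simp [hf, hg]

theorem coneMap_exact (A : GradedRes I) (B : GradedRes Q)
    {φ : ∀ i, (B.chainIdx i → MvPolynomial τ K) →ₗ[MvPolynomial τ K]
      (A.chainIdx i → MvPolynomial τ K)}
    (hφ : ∀ i, A.chainD i ∘ₗ φ (i + 1) = φ i ∘ₗ B.chainD i) (i : ℕ) :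
    Function.Exact (coneMap (A.chainD (i + 2)) (φ (i + 2)) (B.chainD (i + 1)))
      (coneMap (A.chainD (i + 1)) (φ (i + 1)) (B.chainD i)) := by
  intro v
  constructor
  · intro h
    rw [← Sum.elim_zero_zero, coneMap_eq_iff] at h
    exact mem_range_coneMap A B (hφ (i + 1)) v h.1 ((B.chainD_exact i _).1 (neg_eq_zero.1 h.2))
  · rintro ⟨v, rfl⟩
    have h1 := LinearMap.congr_fun (hφ (i + 1)) (v ∘ Sum.inr)
    simp only [LinearMap.comp_apply] at h1
    rw [coneMap_apply, coneMap_apply]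
    simp only [Sum.elim_comp_inl, Sum.elim_comp_inr, map_add, map_neg,
      (A.chainD_exact (i + 1)).apply_apply_eq_zero, (B.chainD_exact i).apply_apply_eq_zero, h1]
    simp

theorem coneMap_exact_coneAug (A : GradedRes I) (B : GradedRes Q)
    {φ : ∀ i, (B.chainIdx i → MvPolynomial τ K) →ₗ[MvPolynomial τ K]
      (A.chainIdx i → MvPolynomial τ K)}
    (hφ : ∀ i, A.chainD i ∘ₗ φ (i + 1) = φ i ∘ₗ B.chainD i)
    (h0 : ∀ v, φ 0 v ∈ LinearMap.range (A.chainD 0) → v ∈ LinearMap.range (B.chainD 0)) :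
    Function.Exact (coneMap (A.chainD 1) (φ 1) (B.chainD 0)) (coneAug (A.chainD 0) (φ 0)) := by
  intro v
  constructor
  · intro h
    refine mem_range_coneMap A B (hφ 0) v h (h0 _ ⟨-(v ∘ Sum.inl), ?_⟩)
    rw [coneAug_apply] at h
    rw [map_neg]
    exact neg_eq_of_add_eq_zero_right h
  · rintro ⟨v, rfl⟩
    have h1 := LinearMap.congr_fun (hφ 0) (v ∘ Sum.inr)
    simp only [LinearMap.comp_apply] at h1
    rw [coneAug_apply, coneMap_apply]
    simp only [Sum.elim_comp_inl, Sum.elim_comp_inr, map_add, map_neg,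
      (A.chainD_exact 0).apply_apply_eq_zero, h1]
    simp

/-- If `Q = (I : w)`, the mapping cone of a comparison map `S/Q(-e) → S/I` over multiplication by
`w` is a resolution of `S / (I + (w))`. When `Q` has a linear resolution and the generators and
syzygies of `I` have degrees at most those of `w` and its linear syzygies, the cone is minimal: the
basis elements of the source of the comparison map then have larger degrees than those of the
target, so that no entry of its matrix is a nonzero constant. -/
theorem exists_cone (A : GradedRes I) (B : GradedRes Q) {w : MvPolynomial τ K} {e : ℕ}
    (hw : w.IsHomogeneous e) (hQ : ∀ p, p ∈ Q ↔ p * w ∈ I)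
    (hB : ∀ i b, B.deg i b = i + 1) (hA : ∀ i b, A.deg i b ≤ i + e) :
    ∃ C : GradedRes (I ⊔ Ideal.span {w}), ∀ i j,
      Nat.card {b // C.deg i b = j} =
        Nat.card {b // A.deg i b = j} + Nat.card {b // B.chainDeg i b + e = j} := by
  let f₀ : (B.chainIdx 0 → MvPolynomial τ K) →ₗ[MvPolynomial τ K]
      (A.chainIdx 0 → MvPolynomial τ K) :=
    w • (LinearMap.id : (Unit → MvPolynomial τ K) →ₗ[MvPolynomial τ K] (Unit → MvPolynomial τ K))
  have hf₀ : ∀ v, f₀ v = fun c => w * v c := fun v => rfl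
  have hgr : IsGradedMap (fun b => B.chainDeg 0 b + e) (A.chainDeg 0) f₀ := by
    intro b c
    refine Or.inr ⟨e, Nat.add_comm _ _, ?_⟩
    rw [hf₀]
    have : (Pi.single b 1 : B.chainIdx 0 → MvPolynomial τ K) c = 1 := by
      rw [show c = b from rfl, Pi.single_eq_same]
    simpa [this] using hw
  have hran : LinearMap.range (f₀ ∘ₗ B.chainD 0) ≤ LinearMap.range (A.chainD 0) := by
    rintro _ ⟨v, rfl⟩
    refine (A.mem_range_aug _).2 ?_
    have h1 := (hQ _).1 ((B.mem_range_aug _).1 (LinearMap.mem_range_self B.aug v))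
    rw [mul_comm] at h1
    exact h1
  obtain ⟨φ, hφ0, hφgr, hφc⟩ := exists_comparison B A e f₀ hgr hran
  have hBmin : ∀ i b c, constantCoeff (B.chainD i (Pi.single b 1) c) = 0 := by
    intro i b c
    refine constantCoeff_eq_zero_of_isHomogVec (B.chainD_graded i b) ?_
    cases i with
    | zero =>
      have := hB 0 b
      simp only [chainDeg]
      omega
    | succ i =>
      have h1 := hB (i + 1) b
      have h2 := hB i c
      simp only [chainDeg]
      omega
  have hφmin : ∀ i b c, constantCoeff (φ (i + 1) (Pi.single b 1) c) = 0 := by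
    intro i b c
    refine constantCoeff_eq_zero_of_isHomogVec (hφgr (i + 1) b) ?_
    have h1 := hB i b
    have h2 := hA i c
    simp only [chainDeg]
    omega
  have haug : ∀ (v : A.chainIdx 1 ⊕ B.chainIdx 0 → MvPolynomial τ K) (c : Unit),
      coneAug (A.chainD 0) (φ 0) v c = A.chainD 0 (v ∘ Sum.inl) c + w * v (Sum.inr c) := by
    intro v c
    rw [coneAug_apply, hφ0]
    rfl
  refine ⟨{
    idx := fun i => A.idx i ⊕ B.chainIdx i
    deg := fun i => Sum.elim (A.deg i) (fun b => B.chainDeg i b + e)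
    aug := coneAug (A.chainD 0) (φ 0)
    d := fun i => coneMap (A.chainD (i + 1)) (φ (i + 1)) (B.chainD i)
    mem_range_aug := ?_
    exact_zero := ?_
    exact_succ := ?_
    aug_graded := ?_
    d_graded := ?_
    minimal := ?_ }, ?_⟩
  · intro p
    rw [Submodule.mem_sup]
    constructor
    · rintro ⟨v, rfl⟩
      refine ⟨A.aug (v ∘ Sum.inl) (), (A.mem_range_aug _).1 (LinearMap.mem_range_self _ _),
        w * v (Sum.inr ()), Ideal.mul_mem_right _ _ (Ideal.mem_span_singleton_self w), ?_⟩
      exact (haug v ()).symm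
    · rintro ⟨x, hx, y, hy, hxy⟩
      obtain ⟨z, rfl⟩ := Ideal.mem_span_singleton.1 hy
      obtain ⟨f, hf⟩ : ∃ f, A.chainD 0 f = fun _ => x := (A.mem_range_aug fun _ => x).2 hx
      refine ⟨Sum.elim f fun _ => z, funext fun c => Eq.trans ?_ hxy⟩
      have h1 := haug (Sum.elim f fun _ => z) c
      rw [Sum.elim_comp_inl, hf] at h1
      exact h1
  · refine coneMap_exact_coneAug A B hφc fun v hv => ?_
    refine (B.mem_range_aug _).2 ((hQ _).2 ?_)
    rw [hφ0, hf₀] at hv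
    rw [mul_comm]
    exact (A.mem_range_aug _).1 hv
  · exact coneMap_exact A B hφc
  · exact isGradedMap_coneAug (A.chainD_graded 0) (hφgr 0)
  · intro i
    exact isGradedMap_coneMap (A.chainD_graded (i + 1)) (hφgr (i + 1))
      ((B.chainD_graded i).shift e)
  · intro i
    exact constantCoeff_coneMap (A.chainD_minimal i) (hφmin i) (hBmin i)
  · intro i j
    simp only
    rw [← Nat.card_sum]
    exact Nat.card_congr Equiv.subtypeSum

end GradedRes

end Cone

/-! ### Monomial ideals with linear quotients -/

section LinearQuotients

variable {τ K : Type*} [Field K]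

/-- The ideal `I` has a minimal graded free resolution with `β i j` basis elements of degree `j` in
homological degree `i`. -/
def HasBetti (I : Ideal (MvPolynomial τ K)) (β : ℕ → ℕ → ℕ) : Prop :=
  ∃ A : GradedRes I, ∀ i j, Nat.card {b // A.deg i b = j} = β i j

theorem HasBetti.congr {I J : Ideal (MvPolynomial τ K)} {β γ : ℕ → ℕ → ℕ}
    (h : HasBetti I β) (hI : I = J) (hβ : ∀ i j, β i j = γ i j) : HasBetti J γ := by
  subst hI
  obtain ⟨A, hA⟩ := h
  exact ⟨A, fun i j => (hA i j).trans (hβ i j)⟩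

theorem GradedRes.card_ne_zero {I : Ideal (MvPolynomial τ K)} (A : GradedRes I) (i : ℕ)
    (b : A.idx i) : Nat.card {c // A.deg i c = A.deg i b} ≠ 0 := by
  have : Nonempty {c // A.deg i c = A.deg i b} := ⟨⟨b, rfl⟩⟩
  exact Nat.card_pos.ne'

theorem hasBetti_bot : HasBetti (⊥ : Ideal (MvPolynomial τ K)) fun _ _ => 0 :=
  ⟨{ idx := fun _ => Empty
     deg := fun _ b => b.elim
     aug := 0
     d := fun _ => 0
     mem_range_aug := fun p => by
      rw [LinearMap.range_zero, Submodule.mem_bot, Ideal.mem_bot]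
      exact ⟨fun h => congrFun h (), fun h => funext fun _ => h⟩
     exact_zero := fun v => ⟨fun _ => ⟨0, Subsingleton.elim _ _⟩, fun _ => rfl⟩
     exact_succ := fun _ v => ⟨fun _ => ⟨0, Subsingleton.elim _ _⟩, fun _ => rfl⟩
     aug_graded := fun b => b.elim
     d_graded := fun _ b => b.elim
     minimal := fun _ b => b.elim }, fun _ _ => by simp⟩

/-- The ranks of the mapping cone in `GradedRes.exists_cone`. The Betti numbers assumed for
`Q = (I : w)` are those of an ideal generated by `q` variables. -/
theorem HasBetti.sup_span_singleton {I Q : Ideal (MvPolynomial τ K)} {β : ℕ → ℕ → ℕ} {q e : ℕ}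
    {w : MvPolynomial τ K} (hI : HasBetti I β)
    (hQ : HasBetti Q fun i j => if j = i + 1 then q.choose (i + 1) else 0)
    (hw : w.IsHomogeneous e) (hIQ : ∀ p, p ∈ Q ↔ p * w ∈ I)
    (hβ : ∀ i j, β i j ≠ 0 → j ≤ i + e) :
    HasBetti (I ⊔ Ideal.span {w}) fun i j =>
      β i j + if j = i + e then q.choose i else 0 := by
  obtain ⟨A, hA⟩ := hI
  obtain ⟨B, hB⟩ := hQ
  have hBdeg : ∀ i b, B.deg i b = i + 1 := by
    intro i b
    by_contra h
    exact B.card_ne_zero i b ((hB _ _).trans (if_neg h))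
  obtain ⟨C, hC⟩ := A.exists_cone B hw hIQ hBdeg
    fun i b => hβ _ _ ((hA _ _).symm.trans_ne (A.card_ne_zero i b))
  refine ⟨C, fun i j => ?_⟩
  rw [hC, hA]
  congr 1
  cases i with
  | zero =>
    change Nat.card {b : Unit // 0 + e = j} = _
    split_ifs with h
    · simp [h]
    · have : IsEmpty {b : Unit // 0 + e = j} := ⟨fun b => h b.2.symm⟩
      exact Nat.card_of_isEmpty
  | succ i =>
    change Nat.card {b : B.idx i // B.deg i b + e = j} = _
    split_ifs with h
    · have h1 := hB i (i + 1)
      simp only [if_true] at h1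
      rw [← h1]
      exact Nat.card_congr (Equiv.subtypeEquivRight fun b => by
        simp [hBdeg, h])
    · have : IsEmpty {b : B.idx i // B.deg i b + e = j} :=
        ⟨fun b => h (by rw [← b.2, hBdeg])⟩
      simp

/-- The ideal generated by the monomials `w u`, `u ∈ G`. -/
def monomialSpan (K : Type*) [Field K] {α : Type*} (w : α → τ →₀ ℕ) (G : Set α) :
    Ideal (MvPolynomial τ K) :=
  Ideal.span ((fun u => monomial (w u) (1 : K)) '' G)

variable {α : Type*} {w : α → τ →₀ ℕ}

theorem mem_monomialSpan {G : Set α} {p : MvPolynomial τ K} :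
    p ∈ monomialSpan K w G ↔ ∀ m ∈ p.support, ∃ u ∈ G, w u ≤ m := by
  have h := MvPolynomial.mem_ideal_span_monomial_image (x := p) (s := w '' G)
  rw [Set.image_image] at h
  simpa [monomialSpan] using h

theorem monomialSpan_insert (G : Set α) (u : α) :
    monomialSpan K w (insert u G) = monomialSpan K w G ⊔ Ideal.span {monomial (w u) 1} := by
  rw [monomialSpan, Set.image_insert_eq, Ideal.span_insert, sup_comm]
  rfl

theorem mul_monomial_mem_monomialSpan {G : Set α} {p : MvPolynomial τ K} (m : τ →₀ ℕ) :
    p * monomial m 1 ∈ monomialSpan K w G ↔ ∀ e ∈ p.support, ∃ u ∈ G, w u ≤ e + m := by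
  classical
  rw [mem_monomialSpan]
  constructor
  · intro h e he
    refine h (e + m) ?_
    rwa [mem_support_iff, coeff_mul_monomial, mul_one, ← mem_support_iff]
  · intro h e he
    rw [mem_support_iff, coeff_mul_monomial'] at he
    split_ifs at he with hm
    · rw [mul_one, ← mem_support_iff] at he
      simpa [tsub_add_cancel_of_le hm] using h _ he
    · exact absurd rfl he

/-- The Betti numbers of an ideal generated by variables, that is, the ranks of the Koszul complex.
The complex is built one variable `X t` at a time, as the cone of multiplication by `X t`. -/
theorem hasBetti_variables [DecidableEq τ] (s : Finset τ) :
    HasBetti (monomialSpan K (fun t => Finsupp.single t 1) (s : Set τ)) fun i j =>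
      if j = i + 1 then s.card.choose (i + 1) else 0 := by
  induction s using Finset.induction_on with
  | empty =>
    refine hasBetti_bot.congr ?_ ?_
    · simp [monomialSpan]
    · simp
  | insert t s ht ih =>
    refine (ih.sup_span_singleton (w := monomial (Finsupp.single t 1) 1) (e := 1) ih
      (isHomogeneous_monomial _ (by simp)) ?_ ?_).congr ?_ ?_
    · intro p
      rw [mul_monomial_mem_monomialSpan, mem_monomialSpan]
      refine forall₂_congr fun e _ => exists_congr fun u => and_congr_right fun hu => ?_
      have hut : u ≠ t := fun h => ht (h ▸ hu)
      simp [Finsupp.single_le_iff, hut.symm]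
    · intro i j h
      by_contra h2
      exact h (if_neg (by omega))
    · rw [Finset.coe_insert, monomialSpan_insert]
    · intro i j
      rw [Finset.card_insert_of_notMem ht]
      split_ifs with h
      · rw [Nat.choose_succ_succ, add_comm]
      · rfl

/-- The Betti numbers of a monomial ideal with linear quotients: the generators `w u`, `u ∈ G`, can
be added in an order with nondecreasing degrees such that the colon ideal of the previous generators
with respect to `w u` is generated by the variables in `Q u`. The order is given by a map `key` that
need not be injective; `hQ` covers every way of breaking ties. -/
theorem hasBetti_of_linearQuotients {κ : Type*} [LinearOrder κ] (key : α → κ) (G : Finset α)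
    (Q : α → Finset τ)
    (hdeg : ∀ u ∈ G, ∀ v ∈ G, key u ≤ key v → (w u).degree ≤ (w v).degree)
    (hQ : ∀ u ∈ G, ∀ T ⊆ G, u ∉ T → (∀ v ∈ T, key v ≤ key u) →
      (∀ v ∈ G, key v < key u → v ∈ T) →
      ∀ e, (∃ v ∈ T, w v ≤ e + w u) ↔ ∃ s ∈ Q u, e s ≠ 0) :
    HasBetti (monomialSpan K w (G : Set α)) fun i j =>
      ∑ u ∈ G, if j = i + (w u).degree then (Q u).card.choose i else 0 := by
  classical
  suffices h : ∀ T : Finset α, T ⊆ G → (∀ u ∈ T, ∀ v ∈ G, key v < key u → v ∈ T) →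
      HasBetti (monomialSpan K w (T : Set α)) fun i j =>
        ∑ u ∈ T, if j = i + (w u).degree then (Q u).card.choose i else 0 from
    h G subset_rfl fun _ _ v hv _ => hv
  intro T
  induction T using Finset.induction_on_max_value key with
  | empty =>
    intro _ _
    refine hasBetti_bot.congr ?_ ?_
    · simp [monomialSpan]
    · simp
  | insert u T hu hmax ih =>
    intro hTG hT
    have hTG' : T ⊆ G := (Finset.subset_insert _ _).trans hTG
    have huG : u ∈ G := hTG (Finset.mem_insert_self _ _)
    have hne : ∀ v ∈ G, ∀ x ∈ insert u T, key v < key x → v ≠ u := by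
      rintro v - x hx hvx rfl
      rcases Finset.mem_insert.1 hx with rfl | hx
      · exact lt_irrefl _ hvx
      · exact (hmax x hx).not_gt hvx
    have hdown : ∀ x ∈ insert u T, ∀ v ∈ G, key v < key x → v ∈ T := fun x hx v hv hvx =>
      Finset.mem_of_mem_insert_of_ne (hT x hx v hv hvx) (hne v hv x hx hvx)
    refine ((ih hTG' fun x hx => hdown x (Finset.mem_insert_of_mem hx)).sup_span_singleton
      (w := monomial (w u) 1) (e := (w u).degree) (hasBetti_variables (Q u))
      (isHomogeneous_monomial _ rfl) ?_ ?_).congr ?_ ?_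
    · intro p
      rw [mul_monomial_mem_monomialSpan, mem_monomialSpan]
      refine forall₂_congr fun e _ => ?_
      have h := hQ u huG T hTG' hu hmax (hdown u (Finset.mem_insert_self _ _)) e
      simp only [Finset.mem_coe]
      rw [h]
      simp [Finsupp.single_le_iff, Nat.one_le_iff_ne_zero]
    · intro i j h
      obtain ⟨v, hv, h⟩ := Finset.exists_ne_zero_of_sum_ne_zero h
      have h1 := hdeg v (hTG' hv) u huG (hmax v hv)
      by_contra h2
      exact h (if_neg (by omega))
    · rw [Finset.coe_insert, monomialSpan_insert]
    · intro i j
      rw [Finset.sum_insert hu, add_comm]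

end LinearQuotients

/-! ### Monomials as nondecreasing words -/

section Words

/-- The monomial `x_{i_1} ⋯ x_{i_k}` of a word `(i_1, …, i_k)`. -/
def wordMonomial (L : List ℕ) : ℕ →₀ ℕ := Multiset.toFinsupp (L : Multiset ℕ)

theorem wordMonomial_apply (L : List ℕ) (s : ℕ) : wordMonomial L s = L.count s := by
  simp [wordMonomial]

theorem wordMonomial_le_iff {L L' : List ℕ} :
    wordMonomial L ≤ wordMonomial L' ↔ ∀ s, L.count s ≤ L'.count s := by
  simp only [Finsupp.le_def, wordMonomial_apply]

theorem wordMonomial_le_of_sublist {L L' : List ℕ} (h : L.Sublist L') :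
    wordMonomial L ≤ wordMonomial L' :=
  wordMonomial_le_iff.2 fun s => h.count_le s

theorem degree_wordMonomial (L : List ℕ) : (wordMonomial L).degree = L.length := by
  have : (wordMonomial L).degree = Multiset.card (Finsupp.toMultiset (wordMonomial L)) :=
    (Finsupp.card_toMultiset (wordMonomial L)).symm
  rw [this, wordMonomial, Multiset.toFinsupp_toMultiset, Multiset.coe_card]

theorem wordMonomial_indices (u : ℕ →₀ ℕ) : wordMonomial (indices u) = u := by
  rw [wordMonomial, indices, Multiset.sort_eq, Finsupp.toMultiset_toFinsupp]

theorem pairwise_indices {ι : Type*} [LinearOrder ι] (u : ι →₀ ℕ) :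
    (indices u).Pairwise (· ≤ ·) :=
  Multiset.pairwise_sort _ _

theorem indices_wordMonomial {L : List ℕ} (hL : L.Pairwise (· ≤ ·)) :
    indices (wordMonomial L) = L := by
  refine List.Perm.eq_of_pairwise (fun a b _ _ => le_antisymm) (pairwise_indices _) hL ?_
  rw [← Multiset.coe_eq_coe, indices, Multiset.sort_eq, wordMonomial, Multiset.toFinsupp_toMultiset]

theorem mem_indices {u : ℕ →₀ ℕ} {s : ℕ} : s ∈ indices u ↔ s ∈ u.support := by
  rw [indices, Multiset.mem_sort, Finsupp.mem_toMultiset]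

theorem prec_wordMonomial {L L' : List ℕ} (hL : L.Pairwise (· ≤ ·)) (hL' : L'.Pairwise (· ≤ ·))
    (h : List.Forall₂ (· ≤ ·) L L') : Prec (wordMonomial L) (wordMonomial L') := by
  rwa [Prec, indices_wordMonomial hL, indices_wordMonomial hL']

theorem degree_eq_length_indices (u : ℕ →₀ ℕ) : u.degree = (indices u).length := by
  conv_lhs => rw [← wordMonomial_indices u, degree_wordMonomial]

/-- The word `(i_1 + f 0, i_2 + f 1, …)` of a word `(i_1, i_2, …)`. -/
def shiftWord (f : ℕ → ℕ) (L : List ℕ) : List ℕ := L.mapIdx fun k i => i + f k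

theorem shiftMap_eq (a : ℕ → ℕ) (u : ℕ →₀ ℕ) :
    shiftMap a u = wordMonomial (shiftWord a (indices u)) :=
  rfl

theorem shiftWord_nil (f : ℕ → ℕ) : shiftWord f [] = [] := rfl

theorem shiftWord_cons (f : ℕ → ℕ) (x : ℕ) (L : List ℕ) :
    shiftWord f (x :: L) = (x + f 0) :: shiftWord (fun k => f (k + 1)) L :=
  List.mapIdx_cons

theorem shiftWord_append (f : ℕ → ℕ) (A B : List ℕ) :
    shiftWord f (A ++ B) = shiftWord f A ++ shiftWord (fun k => f (k + A.length)) B :=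
  List.mapIdx_append

theorem length_shiftWord (f : ℕ → ℕ) (L : List ℕ) : (shiftWord f L).length = L.length :=
  List.length_mapIdx

theorem degree_shiftMap (a : ℕ → ℕ) (u : ℕ →₀ ℕ) : (shiftMap a u).degree = u.degree := by
  rw [shiftMap_eq, degree_wordMonomial, length_shiftWord, degree_eq_length_indices]

theorem le_of_mem_shiftWord {f : ℕ → ℕ} {x c : ℕ} {L : List ℕ} (hf : ∀ k, c ≤ f k)
    (hL : ∀ y ∈ L, x ≤ y) : ∀ z ∈ shiftWord f L, x + c ≤ z := by
  intro z hz
  obtain ⟨i, hi, rfl⟩ := List.mem_mapIdx.1 hz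
  exact add_le_add (hL _ (List.getElem_mem hi)) (hf i)

/-- Suppose that the words `A ≤ A'` (termwise) have entries at most `y` and are shifted by at most
`c`. An entry of the shifted `A` can equal `y + c` only if both its bounds are attained, and then
the same entry of the shifted `A'` equals `y + c`. -/
theorem count_shiftWord_le {A A' : List ℕ} (h : List.Forall₂ (· ≤ ·) A A') {y c : ℕ}
    (hA' : ∀ z ∈ A', z ≤ y) (f : ℕ → ℕ) (hf : ∀ k < A.length, f k ≤ c) :
    (shiftWord f A).count (y + c) ≤ (shiftWord f A').count (y + c) := by
  induction h generalizing f with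
  | nil => simp [shiftWord_nil]
  | @cons x x' A A' hx h ih =>
    have h1 := ih (fun z hz => hA' z (List.mem_cons_of_mem _ hz)) (fun k => f (k + 1))
      fun k hk => hf (k + 1) (by simpa using hk)
    have h2 := hA' x' List.mem_cons_self
    have h3 := hf 0 (by simp)
    rw [shiftWord_cons, shiftWord_cons, List.count_cons, List.count_cons]
    refine add_le_add h1 ?_
    simp only [beq_iff_eq]
    split_ifs <;> omega

theorem forall₂_dropLast_cons {x : ℕ} {L : List ℕ} (h : (x :: L).Pairwise (· ≤ ·)) :
    List.Forall₂ (· ≤ ·) (x :: L).dropLast L := by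
  induction L generalizing x with
  | nil => simp
  | cons y L ih =>
    rw [List.dropLast_cons_cons]
    exact .cons ((List.pairwise_cons.1 h).1 y List.mem_cons_self) (ih (List.pairwise_cons.1 h).2)

theorem forall₂_dropLast_erase {L : List ℕ} (h : L.Pairwise (· ≤ ·)) {s : ℕ} (hs : s ∈ L) :
    List.Forall₂ (· ≤ ·) L.dropLast (L.erase s) := by
  induction L with
  | nil => simp at hs
  | cons x L ih =>
    by_cases hx : x = s
    · subst hx
      rw [List.erase_cons_head]
      exact forall₂_dropLast_cons h
    · rw [List.erase_cons_tail (by simpa using hx)]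
      have hsL : s ∈ L := (List.mem_cons.1 hs).resolve_left (Ne.symm hx)
      rw [List.dropLast_cons_of_ne_nil (List.ne_nil_of_mem hsL)]
      exact .cons le_rfl (ih (List.pairwise_cons.1 h).2 hsL)

theorem exists_split_gt {L : List ℕ} {r : ℕ} (h : ∃ i ∈ L, r < i) :
    ∃ A x B, L = A ++ x :: B ∧ (∀ y ∈ A, y ≤ r) ∧ r < x := by
  induction L with
  | nil => simp at h
  | cons z L ih =>
    by_cases hz : r < z
    · exact ⟨[], z, L, rfl, by simp, hz⟩
    · obtain ⟨i, hi, hri⟩ := h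
      rcases List.mem_cons.1 hi with rfl | hi
      · exact absurd hri hz
      obtain ⟨A, x, B, rfl, hA, hx⟩ := ih ⟨i, hi, hri⟩
      refine ⟨z :: A, x, B, rfl, ?_, hx⟩
      simpa using ⟨not_lt.1 hz, hA⟩

theorem countP_append_cons {A B : List ℕ} {x r : ℕ}
    (hL : (A ++ x :: B).Pairwise (· ≤ ·)) (hA : ∀ y ∈ A, y ≤ r) (hx : r < x) :
    (A ++ x :: B).countP (· ≤ r) = A.length := by
  have hB := (List.pairwise_cons.1 (List.pairwise_append.1 hL).2.1).1
  have h1 : A.countP (· ≤ r) = A.length := List.countP_eq_length.2 (by simpa using hA)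
  have h2 : (x :: B).countP (· ≤ r) = 0 := by
    refine List.countP_eq_zero.2 fun y hy => ?_
    rcases List.mem_cons.1 hy with rfl | hy
    · simpa using hx
    · simpa using hx.trans_le (hB y hy)
  rw [List.countP_append, h1, h2, add_zero]

theorem forall₂_take_or_exists_split (L L' : List ℕ) (h : L'.length ≤ L.length) :
    List.Forall₂ (· ≤ ·) (L.take L'.length) L' ∨
      ∃ A x B A' y B', L = A ++ x :: B ∧ L' = A' ++ y :: B' ∧
        List.Forall₂ (· ≤ ·) A A' ∧ y < x := by
  induction L' generalizing L with
  | nil => simp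
  | cons y L' ih =>
    cases L with
    | nil => simp at h
    | cons x L =>
      by_cases hxy : y < x
      · exact Or.inr ⟨[], x, L, [], y, L', rfl, rfl, .nil, hxy⟩
      · rcases ih L (by simpa using h) with h1 | ⟨A, x', B, A', y', B', rfl, rfl, hA, hy⟩
        · exact Or.inl (by simpa using ⟨not_lt.1 hxy, h1⟩)
        · exact Or.inr ⟨x :: A, x', B, y :: A', y', B', rfl, rfl, .cons (not_lt.1 hxy) hA, hy⟩

theorem eq_of_forall₂_le_of_sum_le {L L' : List ℕ} (h : List.Forall₂ (· ≤ ·) L L')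
    (hs : L'.sum ≤ L.sum) : L = L' := by
  induction h with
  | nil => rfl
  | @cons x x' L L' hx h ih =>
    have h1 := List.Forall₂.sum_le_sum h
    simp only [List.sum_cons] at hs
    rw [ih (by omega), show x = x' by omega]

end Words

/-! ### The colon ideals of the shifted generators -/

section Colon

/-- `M` is the set of monomials of a strongly stable monomial ideal of `K[x_1, x_2, …]`. -/
structure IsStronglyStableSet (M : Set (ℕ →₀ ℕ)) : Prop where
  mem_of_le : ∀ {u v}, u ∈ M → u ≤ v → v ∈ M
  mem_of_prec : ∀ {u v}, v ∈ M → Prec u v → u ∈ M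

variable {M : Set (ℕ →₀ ℕ)}

/-- Every monomial of a strongly stable ideal has a minimal generator as an initial segment: for the
shortest initial segment `P` in the ideal, dropping the last letter of `P` gives a monomial outside
the ideal that precedes in `≺` every monomial obtained from `P` by dropping one letter, so none of
these is in the ideal. -/
theorem IsStronglyStableSet.exists_minimal_take (hM : IsStronglyStableSet M) {L : List ℕ}
    (hL : L.Pairwise (· ≤ ·)) (h : wordMonomial L ∈ M) :
    ∃ t, Minimal (· ∈ M) (wordMonomial (L.take t)) := by
  classical
  have hex : ∃ t, wordMonomial (L.take t) ∈ M := ⟨L.length, by rwa [List.take_length]⟩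
  refine ⟨Nat.find hex, Nat.find_spec hex, fun w hw hwle => ?_⟩
  set t := Nat.find hex
  by_contra hlt
  rw [Finsupp.le_def, not_forall] at hlt
  obtain ⟨s, hs⟩ := hlt
  rw [not_le, wordMonomial_apply] at hs
  have hsP : s ∈ L.take t := List.count_pos_iff.1 (by omega)
  have hP : (L.take t).Pairwise (· ≤ ·) := hL.sublist (List.take_sublist _ _)
  have h1 : wordMonomial ((L.take t).erase s) ∈ M := by
    refine hM.mem_of_le hw fun z => ?_
    have h2 := hwle z
    rw [wordMonomial_apply] at h2 ⊢
    rw [List.count_erase]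
    split_ifs with hz
    · have : s = z := by simpa using hz
      subst this
      omega
    · omega
  have h2 : wordMonomial ((L.take t).dropLast) ∈ M := hM.mem_of_prec h1
    (prec_wordMonomial (hP.sublist (List.dropLast_sublist _)) (hP.sublist List.erase_sublist)
      (forall₂_dropLast_erase hP hsP))
  rw [List.dropLast_eq_take, List.take_take] at h2
  have h3 := Nat.find_min' hex h2
  have h4 : 0 < (L.take t).length := List.length_pos_of_mem hsP
  rw [List.length_take] at h3 h4
  omega

/-- The degree and the sum of the indices of a monomial, ordered lexicographically. Adding the
generators of a strongly stable ideal in this order gives linear quotients. -/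
def lengthSum (u : ℕ →₀ ℕ) : ℕ ×ₗ ℕ := toLex ((indices u).length, (indices u).sum)

/-- The variables that generate the colon ideal of the shifts of the generators before `u` with
respect to the shift of `u`. If `r` is less than the last index of `u` and `p` indices of `u` are at
most `r`, then replacing the index after these by `r` gives a monomial `v ≺ u`, and the shift of `v`
divides `x_{r + a p}` times the shift of `u`. -/
def colonVars (a : ℕ → ℕ) (u : ℕ →₀ ℕ) : Finset ℕ :=
  (Finset.range (maxIndex u - 1)).image fun r => r + a ((indices u).countP (· ≤ r))

variable {a : ℕ → ℕ}

theorem card_colonVars (ha : Monotone a) (u : ℕ →₀ ℕ) :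
    (colonVars a u).card = maxIndex u - 1 := by
  rw [colonVars, Finset.card_image_of_injective, Finset.card_range]
  refine StrictMono.injective fun r r' h => add_lt_add_of_lt_of_le h (ha ?_)
  exact List.countP_mono_left fun x _ hx => by simpa using (by simpa using hx : x ≤ r).trans h.le

theorem lt_maxIndex_sub_one {u : ℕ →₀ ℕ} {r : ℕ} :
    r < maxIndex u - 1 ↔ ∃ i ∈ indices u, r < i := by
  rw [Nat.lt_sub_iff_add_lt, maxIndex, Finset.lt_sup_iff]
  simp [mem_indices]

theorem exists_mem_support_shiftMap_gt {u : ℕ →₀ ℕ} {s : ℕ}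
    (hs : s ∈ colonVars a u) : ∃ t ∈ (shiftMap a u).support, s < t := by
  obtain ⟨r, hr, rfl⟩ := Finset.mem_image.1 hs
  obtain ⟨A, x, B, hu, hA, hx⟩ :=
    exists_split_gt (lt_maxIndex_sub_one.1 (Finset.mem_range.1 hr))
  have hsu := pairwise_indices u
  rw [hu] at hsu
  refine ⟨x + a A.length, ?_, ?_⟩
  · rw [Finsupp.mem_support_iff, shiftMap_eq, wordMonomial_apply, ← Nat.pos_iff_ne_zero,
      List.count_pos_iff, hu, shiftWord_append, shiftWord_cons, zero_add]
    simp
  · rw [hu, countP_append_cons hsu hA hx]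
    omega

theorem shiftMap_take_le (a : ℕ → ℕ) {L : List ℕ} (hL : L.Pairwise (· ≤ ·)) (t : ℕ) :
    shiftMap a (wordMonomial (L.take t)) ≤ shiftMap a (wordMonomial L) := by
  rw [shiftMap_eq, shiftMap_eq, indices_wordMonomial hL,
    indices_wordMonomial (hL.sublist (List.take_sublist _ _))]
  refine wordMonomial_le_of_sublist ?_
  conv_rhs => rw [← List.take_append_drop t L, shiftWord_append]
  exact List.sublist_append_left _ _

/-- The colon ideal of the shifts of the generators before `u` with respect to the shift of `u` is
generated by the variables `colonVars a u`. -/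
theorem exists_shiftMap_le_add_iff (hM : IsStronglyStableSet M) (ha : Monotone a) {u : ℕ →₀ ℕ}
    (hu : Minimal (· ∈ M) u) {T : Set (ℕ →₀ ℕ)} (hT : ∀ v ∈ T, Minimal (· ∈ M) v) (huT : u ∉ T)
    (hle : ∀ v ∈ T, lengthSum v ≤ lengthSum u)
    (hlt : ∀ v, Minimal (· ∈ M) v → lengthSum v < lengthSum u → v ∈ T)
    (e : ℕ →₀ ℕ) :
    (∃ v ∈ T, shiftMap a v ≤ e + shiftMap a u) ↔ ∃ s ∈ colonVars a u, e s ≠ 0 := by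
  constructor
  · rintro ⟨g, hg, hge⟩
    have hls := hle g hg
    rw [lengthSum, lengthSum, Prod.Lex.toLex_le_toLex] at hls
    simp only at hls
    have hlen : (indices g).length ≤ (indices u).length := by omega
    rcases forall₂_take_or_exists_split (indices u) (indices g) hlen with h | h
    -- If `g` is termwise at least an initial segment of `u`, then that segment is in `M`, so it is
    -- all of `u`, and the sums of the indices force `g = u`.
    · exfalso
      have hpre : ((indices u).take (indices g).length).Pairwise (· ≤ ·) :=
        (pairwise_indices u).sublist (List.take_sublist _ _)
      have h1 : wordMonomial ((indices u).take (indices g).length) ∈ M := by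
        refine hM.mem_of_prec (hT g hg).1 ?_
        rwa [Prec, indices_wordMonomial hpre]
      have h2 := hu.2 h1 (by
        conv_rhs => rw [← wordMonomial_indices u]
        exact wordMonomial_le_of_sublist (List.take_sublist _ _))
      have h3 : (indices u).length ≤ (indices g).length := by
        have h4 := Finsupp.degree_mono h2
        rw [degree_eq_length_indices u, degree_wordMonomial, List.length_take] at h4
        omega
      rw [List.take_of_length_le h3] at h
      have h5 := eq_of_forall₂_le_of_sum_le h (by omega)
      have h6 : u = g := by rw [← wordMonomial_indices u, h5, wordMonomial_indices]
      exact huT (h6 ▸ hg)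
    -- Otherwise let `y < x` be the first place where the index of `g` is smaller than that of `u`.
    -- The shifted index `s` of `y` occurs more often in the shift of `g` than in that of `u`.
    · obtain ⟨A, x, B, A', y, B', hLu, hLg, hAA', hyx⟩ := h
      have hsu := pairwise_indices u
      have hsg := pairwise_indices g
      rw [hLu] at hsu
      rw [hLg] at hsg
      have hA'y : ∀ z ∈ A', z ≤ y := fun z hz =>
        (List.pairwise_append.1 hsg).2.2 z hz y List.mem_cons_self
      have hlenA := hAA'.length_eq
      have hAy : ∀ z ∈ A, z ≤ y := by
        intro z hz
        obtain ⟨i, hi, rfl⟩ := List.getElem_of_mem hz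
        exact ((List.forall₂_iff_get.1 hAA').2 i hi (hlenA ▸ hi)).trans
          (hA'y _ (List.getElem_mem _))
      refine ⟨y + a A.length, ?_, ?_⟩
      · refine Finset.mem_image.2 ⟨y, Finset.mem_range.2 (lt_maxIndex_sub_one.2
          ⟨x, by simp [hLu], hyx⟩), ?_⟩
        rw [hLu, countP_append_cons hsu hAy hyx]
      · have h1 := hge (y + a A.length)
        have h2 := count_shiftWord_le hAA' hA'y a fun k hk => ha hk.le
        have h3 : (shiftWord (fun k => a (k + A.length)) (x :: B)).count (y + a A.length) = 0 := by
          rw [List.count_eq_zero]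
          intro hmem
          have hxB : ∀ z ∈ x :: B, x ≤ z := by
            have := (List.pairwise_cons.1 (List.pairwise_append.1 hsu).2.1).1
            simpa using this
          have := le_of_mem_shiftWord (fun k => ha (Nat.le_add_left A.length k)) hxB _ hmem
          omega
        rw [Finsupp.add_apply, shiftMap_eq, shiftMap_eq, wordMonomial_apply, wordMonomial_apply,
          hLu, hLg,
          shiftWord_append, shiftWord_append, List.count_append, List.count_append, h3,
          shiftWord_cons, List.count_cons, ← hlenA, zero_add] at h1
        simp only [beq_self_eq_true, if_true] at h1
        omega
  · rintro ⟨s, hs, hes⟩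
    obtain ⟨r, hr, rfl⟩ := Finset.mem_image.1 hs
    obtain ⟨A, x, B, hLu, hA, hx⟩ :=
      exists_split_gt (lt_maxIndex_sub_one.1 (Finset.mem_range.1 hr))
    have hsu := pairwise_indices u
    rw [hLu] at hsu
    rw [hLu, countP_append_cons hsu hA hx] at hes
    have hsv : (A ++ r :: B).Pairwise (· ≤ ·) := by
      rw [List.pairwise_append, List.pairwise_cons] at hsu ⊢
      obtain ⟨h1, ⟨h2, h3⟩, h4⟩ := hsu
      refine ⟨h1, ⟨fun b hb => hx.le.trans (h2 b hb), h3⟩, fun y hy z hz => ?_⟩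
      rcases List.mem_cons.1 hz with rfl | hz
      · exact hA y hy
      · exact h4 y hy z (List.mem_cons_of_mem _ hz)
    have hvM : wordMonomial (A ++ r :: B) ∈ M := by
      refine hM.mem_of_prec hu.1 ?_
      rw [Prec, indices_wordMonomial hsv, hLu]
      exact List.rel_append (List.forall₂_refl A) (.cons hx.le (List.forall₂_refl B))
    obtain ⟨t, ht⟩ := hM.exists_minimal_take hsv hvM
    refine ⟨_, hlt _ ht ?_, (shiftMap_take_le a hsv t).trans ?_⟩
    · rw [lengthSum, lengthSum, indices_wordMonomial (hsv.sublist (List.take_sublist _ _)),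
        Prod.Lex.toLex_lt_toLex, hLu]
      by_cases htl : t < (A ++ r :: B).length
      · left
        simp only [List.length_take, List.length_append, List.length_cons] at htl ⊢
        omega
      · right
        rw [List.take_of_length_le (not_lt.1 htl)]
        simp only [List.length_append, List.length_cons, List.sum_append, List.sum_cons, true_and]
        omega
    · intro z
      rw [Finsupp.add_apply, shiftMap_eq, shiftMap_eq, indices_wordMonomial hsv, hLu,
        wordMonomial_apply, wordMonomial_apply,
        shiftWord_append, shiftWord_append, List.count_append, List.count_append,
        shiftWord_cons, shiftWord_cons, List.count_cons, List.count_cons, zero_add]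
      simp only [beq_iff_eq]
      split_ifs with h1 h2 h2
      · omega
      · subst h1
        omega
      · omega
      · omega

end Colon

/-! ### Passing to finitely many variables -/

section Restrict

variable {K : Type*} [Field K] {n : ℕ}

theorem mapDomain_le_mapDomain {u v : Fin n →₀ ℕ} :
    u.mapDomain Fin.val ≤ v.mapDomain Fin.val ↔ u ≤ v := by
  constructor
  · intro h i
    have := h i
    rwa [Finsupp.mapDomain_apply Fin.val_injective, Finsupp.mapDomain_apply Fin.val_injective]
      at this
  · exact fun h => Finsupp.mapDomain_mono h

theorem exists_mapDomain_eq {u : ℕ →₀ ℕ} (h : ∀ i ∈ u.support, i < n) :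
    ∃ v : Fin n →₀ ℕ, v.mapDomain Fin.val = u :=
  ⟨u.comapDomain Fin.val Fin.val_injective.injOn,
    Finsupp.mapDomain_comapDomain _ Fin.val_injective _ fun i hi => ⟨⟨i, h i hi⟩, rfl⟩⟩

theorem indices_mapDomain (u : Fin n →₀ ℕ) :
    indices (u.mapDomain Fin.val) = (indices u).map Fin.val := by
  refine List.Perm.eq_of_pairwise (fun a b _ _ => le_antisymm) (pairwise_indices _)
    ((pairwise_indices u).map _ fun _ _ h => h) ?_
  rw [← Multiset.coe_eq_coe, indices, Multiset.sort_eq, ← Finsupp.toMultiset_map, indices,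
    ← Multiset.map_coe, Multiset.sort_eq]

theorem prec_mapDomain {u v : Fin n →₀ ℕ} :
    Prec (u.mapDomain Fin.val) (v.mapDomain Fin.val) ↔ Prec u v := by
  rw [Prec, Prec, indices_mapDomain, indices_mapDomain, List.forall₂_map_left_iff,
    List.forall₂_map_right_iff]
  rfl

theorem monomial_mem_restrictTo {I : Ideal (MvPolynomial ℕ K)} {u : Fin n →₀ ℕ} :
    monomial u (1 : K) ∈ restrictTo n I ↔ monomial (u.mapDomain Fin.val) (1 : K) ∈ I := by
  rw [restrictTo, Ideal.mem_comap, rename_monomial]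

theorem restrictTo_monomialSpan {α : Type*} {w : α → ℕ →₀ ℕ} {w' : α → Fin n →₀ ℕ} {G : Set α}
    (h : ∀ u ∈ G, (w' u).mapDomain Fin.val = w u) :
    restrictTo n (monomialSpan K w G) = monomialSpan K w' G := by
  classical
  ext p
  rw [restrictTo, Ideal.mem_comap, mem_monomialSpan, mem_monomialSpan,
    support_rename_of_injective Fin.val_injective, Finset.forall_mem_image]
  refine forall₂_congr fun m _ => exists_congr fun u => and_congr_right fun hu => ?_
  rw [← h u hu, mapDomain_le_mapDomain]

theorem monomial_mem_monomialSpan {τ α : Type*} {w : α → τ →₀ ℕ} {G : Set α} {m : τ →₀ ℕ} :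
    monomial m (1 : K) ∈ monomialSpan K w G ↔ ∃ u ∈ G, w u ≤ m := by
  classical
  rw [mem_monomialSpan, support_monomial, if_neg one_ne_zero]
  simp

end Restrict

/-! ### Minimal generators and the Betti numbers of shifted ideals -/

section MinGens

variable {K : Type*} [Field K] {I : Ideal (MvPolynomial ℕ K)}

theorem monomial_mem_of_le {τ : Type*} {I : Ideal (MvPolynomial τ K)} {u v : τ →₀ ℕ}
    (hu : monomial u (1 : K) ∈ I) (h : u ≤ v) : monomial v (1 : K) ∈ I := by
  rw [← tsub_add_cancel_of_le h, show monomial (v - u + u) (1 : K) =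
    monomial (v - u) 1 * monomial u 1 by rw [monomial_mul, one_mul]]
  exact Ideal.mul_mem_left _ _ hu

theorem exists_minGens_le {v : ℕ →₀ ℕ} (hv : monomial v (1 : K) ∈ I) :
    ∃ u ∈ minGens I, u ≤ v := by
  obtain ⟨u, huv, hu⟩ := exists_minimal_le_of_wellFoundedLT
    (fun v => monomial v (1 : K) ∈ I) v hv
  exact ⟨u, hu, huv⟩

theorem eq_monomialSpan_minGens (hI : IsMonomialIdeal I) : I = monomialSpan K id (minGens I) := by
  refine le_antisymm ?_ ?_
  · obtain ⟨A, hA⟩ := hI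
    intro p hp
    rw [hA, mem_ideal_span_monomial_image] at hp
    rw [mem_monomialSpan]
    intro m hm
    obtain ⟨v, hv, hvm⟩ := hp m hm
    obtain ⟨u, hu, huv⟩ := exists_minGens_le (I := I) (v := v)
      (hA ▸ Ideal.subset_span (Set.mem_image_of_mem _ hv))
    exact ⟨u, hu, huv.trans hvm⟩
  · refine Ideal.span_le.2 ?_
    rintro _ ⟨u, hu, rfl⟩
    exact hu.1

theorem minGens_monomialSpan_subset {α : Type*} {w : α → ℕ →₀ ℕ} {G : Set α} :
    minGens (monomialSpan K w G) ⊆ w '' G := by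
  intro m hm
  obtain ⟨u, hu, hum⟩ := monomial_mem_monomialSpan.1 hm.1
  exact ⟨u, hu, le_antisymm hum (hm.2 (monomial_mem_monomialSpan.2 ⟨u, hu, le_rfl⟩) hum)⟩

open Classical in
theorem finite_minGens (hfg : I.FG) (hI : IsMonomialIdeal I) : (minGens I).Finite := by
  obtain ⟨A, hA⟩ := hI
  have hfg' : (Submodule.span (MvPolynomial ℕ K) ((fun u => monomial u (1 : K)) '' A)).FG := by
    rw [hA] at hfg
    exact hfg
  obtain ⟨B, hB, hBspan⟩ := Submodule.fg_span_iff_fg_span_finset_subset _ |>.1 hfg'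
  obtain ⟨C, -, rfl⟩ := Finset.subset_set_image_iff.1 hB
  have : I = monomialSpan K id (C : Set (ℕ →₀ ℕ)) := by
    rw [hA]
    refine hBspan.trans ?_
    rw [Finset.coe_image]
    rfl
  rw [this]
  exact (C.finite_toSet.image id).subset minGens_monomialSpan_subset

theorem maxIndex_le_maxVar (hfin : (minGens I).Finite) {u : ℕ →₀ ℕ} (hu : u ∈ minGens I) :
    ∀ i ∈ u.support, i < maxVar I := by
  intro i hi
  have h1 : maxIndex u ≤ maxVar I :=
    le_csSup (hfin.image _).bddAbove (Set.mem_image_of_mem _ hu)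
  have h2 : i + 1 ≤ maxIndex u := Finset.le_sup (f := (· + 1)) hi
  omega

theorem exists_sublist_forall₂ {A B C : List ℕ} (h : List.Forall₂ (· ≤ ·) A B)
    (hC : C.Sublist B) : ∃ D, D.Sublist A ∧ List.Forall₂ (· ≤ ·) D C := by
  induction hC generalizing A with
  | slnil => exact ⟨[], List.nil_sublist _, .nil⟩
  | cons x _ ih =>
    cases h with
    | cons hx h =>
      obtain ⟨D, hD, hDC⟩ := ih h
      exact ⟨D, hD.cons _, hDC⟩
  | cons_cons x _ ih =>
    cases h with
    | @cons y _ A _ hx h =>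
      obtain ⟨D, hD, hDC⟩ := ih h
      exact ⟨y :: D, hD.cons_cons _, .cons hx hDC⟩

theorem indices_sublist {u v : ℕ →₀ ℕ} (h : u ≤ v) : (indices u).Sublist (indices v) := by
  refine List.sublist_of_subperm_of_pairwise ?_ (pairwise_indices u) (pairwise_indices v)
  rw [← Multiset.coe_le, indices, indices, Multiset.sort_eq, Multiset.sort_eq]
  exact Finsupp.orderIsoMultiset.monotone h

/-- Strong stability in the variables up to `max(I)` implies strong stability in all variables: if
`u ≺ v` and a minimal generator `g` divides `v`, then the part of `u` in the positions of `g`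
divides `u` and precedes `g`, so that it involves only the variables of index at most `max(I)`. -/
theorem IsFGStronglyStable.isStronglyStableSet (hI : IsFGStronglyStable I) :
    IsStronglyStableSet {u | monomial u (1 : K) ∈ I} := by
  obtain ⟨hfg, hmonom, -, hss⟩ := hI
  refine ⟨fun hu h => monomial_mem_of_le hu h, fun {u v} hv huv => ?_⟩
  obtain ⟨g, hg, hgv⟩ := exists_minGens_le hv
  obtain ⟨D, hDu, hDg⟩ := exists_sublist_forall₂ huv (indices_sublist hgv)
  have hD : D.Pairwise (· ≤ ·) := (pairwise_indices u).sublist hDu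
  have hlt := maxIndex_le_maxVar (finite_minGens hfg hmonom) hg
  have hDlt : ∀ i ∈ (wordMonomial D).support, i < maxVar I := by
    intro i hi
    rw [← mem_indices, indices_wordMonomial hD] at hi
    obtain ⟨k, hk, rfl⟩ := List.getElem_of_mem hi
    have hk' : k < (indices g).length := hDg.length_eq ▸ hk
    exact ((List.forall₂_iff_get.1 hDg).2 k hk hk').trans_lt
      (hlt _ (mem_indices.1 (List.getElem_mem hk')))
  obtain ⟨g', rfl⟩ := exists_mapDomain_eq hlt
  obtain ⟨d', hd'⟩ := exists_mapDomain_eq hDlt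
  have h1 := hss d' g' (monomial_mem_restrictTo.2 hg.1) (by
    rw [← prec_mapDomain, hd', Prec, indices_wordMonomial hD]
    exact hDg)
  rw [monomial_mem_restrictTo, hd'] at h1
  refine monomial_mem_of_le h1 ?_
  conv_rhs => rw [← wordMonomial_indices u]
  exact wordMonomial_le_of_sublist hDu

theorem opIdeal_eq (σ : (ℕ →₀ ℕ) → (ℕ →₀ ℕ)) (I : Ideal (MvPolynomial ℕ K)) :
    opIdeal σ I = monomialSpan K σ (minGens I) := rfl

theorem opIdeal_shiftMap_mono (a : ℕ → ℕ) {I J : Ideal (MvPolynomial ℕ K)}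
    (hI : IsFGStronglyStable I) (hJI : J ≤ I) :
    opIdeal (shiftMap a) J ≤ opIdeal (shiftMap a) I := by
  rw [opIdeal_eq, opIdeal_eq, monomialSpan, Ideal.span_le]
  rintro _ ⟨u, hu, rfl⟩
  obtain ⟨t, ht⟩ := hI.isStronglyStableSet.exists_minimal_take (pairwise_indices u)
    (by rw [wordMonomial_indices]; exact hJI hu.1)
  refine monomial_mem_monomialSpan.2 ⟨_, ht, ?_⟩
  have h := shiftMap_take_le a (pairwise_indices u) t
  rwa [wordMonomial_indices] at h

variable {a : ℕ → ℕ}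

theorem eq_of_le_of_degree_le {τ : Type*} {u v : τ →₀ ℕ} (h : u ≤ v)
    (hd : v.degree ≤ u.degree) : u = v := by
  obtain ⟨w, rfl⟩ := exists_add_of_le h
  rw [map_add] at hd
  have hw : w = 0 := (Finsupp.degree_eq_zero_iff w).1 (by omega)
  rw [hw, add_zero]

theorem length_le_of_lengthSum_le {u v : ℕ →₀ ℕ} (h : lengthSum u ≤ lengthSum v) :
    (indices u).length ≤ (indices v).length := by
  rw [lengthSum, lengthSum, Prod.Lex.toLex_le_toLex] at h
  simp only at h
  omega

/-- The shifts of the minimal generators are minimal generators: a colon ideal generated by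
variables is proper, so no shifted generator is divisible by an earlier one. -/
theorem mem_minGens_opIdeal_shiftMap (ha : Monotone a) (hI : IsFGStronglyStable I)
    {u : ℕ →₀ ℕ} (hu : u ∈ minGens I) :
    shiftMap a u ∈ minGens (opIdeal (shiftMap a) I) := by
  have hM := hI.isStronglyStableSet
  have hmin : ∀ v ∈ minGens I, shiftMap a v ≤ shiftMap a u → v = u := by
    intro v hv hvu
    by_contra hne
    have haux : ∀ x ∈ minGens I, ∀ y ∈ minGens I, lengthSum x ≤ lengthSum y → x ≠ y →
        ¬ shiftMap a x ≤ shiftMap a y := by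
      intro x hx y hy hxy hne hle
      obtain ⟨s, -, hs⟩ := (exists_shiftMap_le_add_iff hM ha hy
        (T := {z | z ∈ minGens I ∧ lengthSum z ≤ lengthSum y ∧ z ≠ y}) (fun z hz => hz.1)
        (fun h => h.2.2 rfl) (fun z hz => hz.2.1)
        (fun z hz hzy => ⟨hz, hzy.le, fun h => hzy.ne (congrArg lengthSum h)⟩) 0).1
        ⟨x, ⟨hx, hxy, hne⟩, by rwa [zero_add]⟩
      exact hs rfl
    rcases le_total (lengthSum v) (lengthSum u) with h | h
    · exact haux v hv u hu h hne hvu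
    · refine haux u hu v hv h (Ne.symm hne) (le_of_eq (eq_of_le_of_degree_le hvu ?_).symm)
      rw [degree_shiftMap, degree_shiftMap, degree_eq_length_indices, degree_eq_length_indices]
      exact length_le_of_lengthSum_le h
  refine ⟨monomial_mem_monomialSpan.2 ⟨u, hu, le_rfl⟩, fun m hm hmu => ?_⟩
  obtain ⟨v, hv, hvm⟩ := monomial_mem_monomialSpan.1 hm
  rwa [hmin v hv (hvm.trans hmu)] at hvm

/-- The Betti numbers of a shifted strongly stable ideal, in a form that does not involve `a`. -/
theorem betti_opIdeal_shiftMap (ha : Monotone a) (hI : IsFGStronglyStable I) (i j : ℕ) :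
    betti (opIdeal (shiftMap a) I) i j =
      ∑ᶠ u ∈ minGens I, if j = i + u.degree then (maxIndex u - 1).choose i else 0 := by
  classical
  have hfin := finite_minGens hI.1 hI.2.1
  have hM := hI.isStronglyStableSet
  set n := maxVar (opIdeal (shiftMap a) I) with hn
  have hfin' : (minGens (opIdeal (shiftMap a) I)).Finite :=
    (hfin.image (shiftMap a)).subset minGens_monomialSpan_subset
  have hlt : ∀ u ∈ minGens I, ∀ i ∈ (shiftMap a u).support, i < n := fun u hu =>
    maxIndex_le_maxVar hfin' (mem_minGens_opIdeal_shiftMap ha hI hu)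
  have hex : ∀ u, ∃ v : Fin n →₀ ℕ, u ∈ minGens I → v.mapDomain Fin.val = shiftMap a u := by
    intro u
    by_cases hu : u ∈ minGens I
    · obtain ⟨v, hv⟩ := exists_mapDomain_eq (hlt u hu)
      exact ⟨v, fun _ => hv⟩
    · exact ⟨0, fun h => absurd h hu⟩
  choose w hw using hex
  have hdeg : ∀ u ∈ minGens I, (w u).degree = u.degree := by
    intro u hu
    rw [← degree_shiftMap a u, ← hw u hu, Finsupp.degree_mapDomain]
  let Q : (ℕ →₀ ℕ) → Finset (Fin n) := fun u =>
    (colonVars a u).preimage Fin.val Fin.val_injective.injOn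
  have hQcard : ∀ u ∈ minGens I, (Q u).card = maxIndex u - 1 := by
    intro u hu
    rw [← card_colonVars ha u, ← Finset.card_image_of_injective (Q u) Fin.val_injective]
    congr 1
    ext s
    simp only [Q, Finset.mem_image, Finset.mem_preimage]
    refine ⟨fun ⟨t, ht, hts⟩ => hts ▸ ht, fun hs => ?_⟩
    obtain ⟨t, ht, hst⟩ := exists_mem_support_shiftMap_gt hs
    exact ⟨⟨s, hst.trans (hlt u hu t ht)⟩, hs, rfl⟩
  have hlin := hasBetti_of_linearQuotients (K := K) (w := w) lengthSum hfin.toFinset Q ?_ ?_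
  · obtain ⟨A, hA⟩ := hlin
    have hres : restrictTo n (opIdeal (shiftMap a) I) =
        monomialSpan K w (hfin.toFinset : Set (ℕ →₀ ℕ)) := by
      rw [opIdeal_eq, restrictTo_monomialSpan hw, hfin.coe_toFinset]
    rw [betti, ← hn, hres, A.gradedBetti_eq, hA, finsum_mem_eq_finite_toFinset_sum _ hfin]
    refine Finset.sum_congr rfl fun u hu => ?_
    rw [Set.Finite.mem_toFinset] at hu
    rw [hdeg u hu, hQcard u hu]
  · intro u hu v hv huv
    rw [Set.Finite.mem_toFinset] at hu hv
    rw [hdeg u hu, hdeg v hv, degree_eq_length_indices, degree_eq_length_indices]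
    exact length_le_of_lengthSum_le huv
  · intro u hu T hT huT hle hlt e
    rw [Set.Finite.mem_toFinset] at hu
    have hT' : ∀ v ∈ T, v ∈ minGens I := fun v hv => hfin.mem_toFinset.1 (hT hv)
    have h := exists_shiftMap_le_add_iff hM ha hu (T := (T : Set (ℕ →₀ ℕ))) hT' huT hle
      (fun v hv h => hlt v (hfin.mem_toFinset.2 hv) h) (e.mapDomain Fin.val)
    have h1 : (∃ v ∈ T, w v ≤ e + w u) ↔
        ∃ v ∈ (T : Set (ℕ →₀ ℕ)), shiftMap a v ≤ e.mapDomain Fin.val + shiftMap a u := by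
      refine exists_congr fun v => and_congr_right fun hv => ?_
      rw [← hw u hu, ← hw v (hT' v hv), ← Finsupp.mapDomain_add, mapDomain_le_mapDomain]
    rw [h1, h]
    constructor
    · rintro ⟨s, hs, hes⟩
      have hsr : s ∈ (e.mapDomain Fin.val).support := Finsupp.mem_support_iff.2 hes
      obtain ⟨t, ht, rfl⟩ := Finset.mem_image.1 (Finsupp.mapDomain_support hsr)
      exact ⟨t, Finset.mem_preimage.2 hs, Finsupp.mem_support_iff.1 ht⟩
    · rintro ⟨t, ht, het⟩
      exact ⟨t, Finset.mem_preimage.1 ht, by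
        rwa [Finsupp.mapDomain_apply Fin.val_injective]⟩

theorem shiftWord_zero (L : List ℕ) : shiftWord (fun _ => 0) L = L := by
  induction L with
  | nil => rfl
  | cons x L ih => rw [shiftWord_cons, ih, add_zero]

theorem shiftMap_zero (u : ℕ →₀ ℕ) : shiftMap (fun _ => 0) u = u := by
  rw [shiftMap_eq, shiftWord_zero, wordMonomial_indices]

theorem opIdeal_shiftMap_zero (hI : IsMonomialIdeal I) : opIdeal (shiftMap fun _ => 0) I = I := by
  conv_rhs => rw [eq_monomialSpan_minGens hI]
  rw [opIdeal_eq, show shiftMap (fun _ => 0) = id from funext shiftMap_zero]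

end MinGens

end StableOp

end

theorem proposition1p8 (K : Type*) [Field K] (a : ℕ → ℕ) (ha₀ : a 0 = 0) (ha : Monotone a) :
    StableOp.IsStableOperator K (StableOp.shiftMap a) where
  betti_eq I hI i j := by
    conv_lhs => rw [← StableOp.opIdeal_shiftMap_zero hI.2.1]
    rw [StableOp.betti_opIdeal_shiftMap monotone_const hI,
      StableOp.betti_opIdeal_shiftMap ha hI]
  mono I J hI _ hJI := StableOp.opIdeal_shiftMap_mono a hI hJI
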